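/- Let $\mathbf S^2\subset\mathbf R^3$ be the unit sphere, oriented by its outward normal. A *geodesic segment* is an oriented arc of a great circle of length $\ell\in[0,2\pi]$; its midpoint is the point of the arc at distance $\ell/2$ along it from the starting point. A *geodesic triangle* $\Delta(abc)$ consists of points $a,b,c\in\mathbf S^2$ and geodesic segments $\overline{ab},\overline{bc},\overline{ca}$, at most one of which is longer than $\pi$. Its *oriented area* is a real number modulo $4\pi$: choose any point $n\in\mathbf S^2$ that does not lie on the sides, to be regarded as exterior, and integrate over $\mathbf S^2$, with respect to the surface measure, the winding number in $\mathbf S^2\setminus\{n\}\cong\mathbf R^2$ (an orientation-preserving identification by stereographic projection) of the closed curve $a\to b\to c\to a$ around the variable point; when the curve is simple, this is $\pm$ the area of the component of its complement not containing $n$. **Proposition.** Let $\alpha,\beta,\gamma\in\mathbf S^2$ be such that none of the Euclidean inner products $\langle\alpha,\beta\rangle,\langle\beta,\gamma\rangle,\langle\gamma,\alpha\rangle$ is zero. Then there is a geodesic triangle $\Delta(abc)$ such that $\alpha,\beta,\gamma$ are the midpoints of $\overline{bc},\overline{ca},\overline{ab}$ respectively. It is unique: its corners, the lengths of its sides, and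 each of its sides of length less than $2\pi$ are determined by $\alpha,\beta,\gamma$ (a side of length $2\pi$, which occurs only if its end points coincide, may be any full great circle through its midpoint). For every such triangle, the oriented area is well defined modulo $4\pi$, independently of the choice of $n$, and a real number $\Omega$ represents it if and only if $$e^{i\Omega/2}=\eta\sqrt{1-\det(\alpha\beta\gamma)^2}+i\det(\alpha\beta\gamma),$$ where $\eta\in\{1,-1\}$ is the sign of the majority of the signs of $\langle\alpha,\beta\rangle$, $\langle\beta,\gamma\rangle$, $\langle\gamma,\alpha\rangle$. -/

import Mathlib

open scoped RealInnerProductSpace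

noncomputable section

/-- Euclidean three-space. -/
abbrev E3 : Type := EuclideanSpace ℝ (Fin 3)

/-- The unit sphere of Euclidean three-space. -/
abbrev S2 : Type := Metric.sphere (0 : E3) 1

/-- The determinant of three vectors of three-space. -/
def det3 (u v w : E3) : ℝ := (Matrix.of ![u.ofLp, v.ofLp, w.ofLp]).det

/-- The common sign of the majority of three nonzero real numbers. -/
def majoritySign (x y z : ℝ) : ℝ := Real.sign (Real.sign x + Real.sign y + Real.sign z)

/-- An oriented geodesic segment (arc of a great circle) on the sphere: it leaves the point
`start` in the direction of the unit tangent vector `dir` and has length `len`, which is at most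
the length of a full great circle. -/
structure GeodesicSegment where
  start : S2
  dir : E3
  norm_dir : ‖dir‖ = 1
  inner_start_dir : ⟪(start : E3), dir⟫ = 0
  len : ℝ
  len_nonneg : 0 ≤ len
  len_le : len ≤ 2 * Real.pi

namespace GeodesicSegment

/-- The parametrisation by arc length; the segment is its restriction to `[0, len]`. -/
def point (s : GeodesicSegment) (t : ℝ) : E3 := Real.cos t • (s.start : E3) + Real.sin t • s.dir

/-- The end point. -/
def finish (s : GeodesicSegment) : E3 := s.point s.len

/-- The midpoint of the segment. -/
def midpoint (s : GeodesicSegment) : E3 := s.point (s.len / 2)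

/-- The set of points of the segment. -/
def carrier (s : GeodesicSegment) : Set E3 := s.point '' Set.Icc 0 s.len

/-- Two segments have the same end points and length and, unless they are full great circles,
run through the same points (a full great circle is not determined by its end points and
its midpoint). -/
def Same (s s' : GeodesicSegment) : Prop :=
  s.start = s'.start ∧ s.finish = s'.finish ∧ s.len = s'.len ∧
    (s.len < 2 * Real.pi → Set.EqOn s.point s'.point (Set.Icc 0 s.len))

end GeodesicSegment

/-- A geodesic triangle on the sphere with corners `a, b, c`, given by its oriented sides
`ab`, `bc`, `ca`, at most one of which is longer than a half circle. -/
structure GeodesicTriangle where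
  ab : GeodesicSegment
  bc : GeodesicSegment
  ca : GeodesicSegment
  ab_finish : ab.finish = bc.start
  bc_finish : bc.finish = ca.start
  ca_finish : ca.finish = ab.start
  not_long_ab_bc : ¬ (Real.pi < ab.len ∧ Real.pi < bc.len)
  not_long_bc_ca : ¬ (Real.pi < bc.len ∧ Real.pi < ca.len)
  not_long_ca_ab : ¬ (Real.pi < ca.len ∧ Real.pi < ab.len)

namespace GeodesicTriangle

/-- The corner `a`. -/
def a (T : GeodesicTriangle) : S2 := T.ab.start

/-- The corner `b`. -/
def b (T : GeodesicTriangle) : S2 := T.bc.start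

/-- The corner `c`. -/
def c (T : GeodesicTriangle) : S2 := T.ca.start

/-- `α`, `β`, `γ` are the midpoints of the sides `bc`, `ca`, `ab` respectively. -/
def HasMidpoints (T : GeodesicTriangle) (α β γ : S2) : Prop :=
  T.bc.midpoint = α ∧ T.ca.midpoint = β ∧ T.ab.midpoint = γ

/-- The closed curve formed by the three sides. -/
def boundary (T : GeodesicTriangle) : Set E3 := T.ab.carrier ∪ T.bc.carrier ∪ T.ca.carrier

/-- Two triangles have the same corners and the same sides. -/
def Same (T T' : GeodesicTriangle) : Prop :=
  T.a = T'.a ∧ T.b = T'.b ∧ T.c = T'.c ∧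
    T.ab.Same T'.ab ∧ T.bc.Same T'.bc ∧ T.ca.Same T'.ca

end GeodesicTriangle

/-- Stereographic projection from the point `-e 2`, which is sent to infinity, onto the plane
spanned by `e 0` and `e 1`, identified with `ℂ`. If the orthonormal basis `e` is positively
oriented, it preserves orientation (the sphere is oriented by its outward normal). -/
def stereo (e : OrthonormalBasis (Fin 3) ℝ E3) (x : E3) : ℂ :=
  ((⟪e 0, x⟫ : ℂ) + (⟪e 1, x⟫ : ℂ) * Complex.I) / (1 + (⟪e 2, x⟫ : ℂ))

/-- The contour integral of `dz / (z - ζ)` along the stereographic image of a segment. -/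
def GeodesicSegment.contourIntegral (e : OrthonormalBasis (Fin 3) ℝ E3) (s : GeodesicSegment)
    (ζ : ℂ) : ℂ :=
  ∫ t in (0 : ℝ)..s.len,
    deriv (fun r : ℝ => stereo e (s.point r)) t / (stereo e (s.point t) - ζ)

namespace GeodesicTriangle

/-- The number of times that the closed curve `a → b → c → a` winds around the point `x` in the
sphere punctured at `-e 2`, that is, the winding number of its image in `ℂ` around the image
of `x`. -/
def windingNumber (T : GeodesicTriangle) (e : OrthonormalBasis (Fin 3) ℝ E3) (x : E3) : ℝ :=
  ((T.ab.contourIntegral e (stereo e x) + T.bc.contourIntegral e (stereo e x) +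
    T.ca.contourIntegral e (stereo e x)) / (2 * Real.pi * Complex.I)).re

/-- The oriented area of the part of the sphere that the closed curve `a → b → c → a` encloses
when `-e 2` is taken to be an exterior point: points are counted with their winding numbers.
The measure is the surface measure of the sphere, of total mass `4π`. When the curve is simple,
this is the area of the component of its complement that does not contain `-e 2`, with sign `+` if
the curve runs counterclockwise around it and `-` otherwise. -/
def areaAvoiding (T : GeodesicTriangle) (e : OrthonormalBasis (Fin 3) ℝ E3) : ℝ :=
  ∫ x : S2, T.windingNumber e x ∂(MeasureTheory.volume : MeasureTheory.Measure E3).toSphere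

/-- `Ω` represents the oriented area modulo `4π` of the triangle: it is congruent modulo `4π` to
the oriented area for some choice of the interior, i.e. of an exterior point `-e 2` that does not
lie on the sides. -/
def IsOrientedArea (T : GeodesicTriangle) (Ω : ℝ) : Prop :=
  ∃ e : OrthonormalBasis (Fin 3) ℝ E3, det3 (e 0) (e 1) (e 2) = 1 ∧ -e 2 ∉ T.boundary ∧
    ∃ k : ℤ, Ω = T.areaAvoiding e + 4 * Real.pi * k

end GeodesicTriangle

end

/-! The half-turn about the midpoint of a side carries its starting corner to its end. Going once
around the triangle gives linear equations that force k • a = `cornerVector α β γ`, with k² = 1 -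
det² by a Gram determinant. The products of each corner with the midpoint that follows are the given
inner products divided by k. A side is longer than π exactly when its product is negative, so
allowing at most one long side forces k to have the majority sign η. This gives existence and
uniqueness.

For the area, winding numbers are never computed: the integral over the sphere is exchanged with the
contour integrals. The Cauchy transform of the surface measure in the stereographic coordinate is
explicit (`integral_inv_stereo_sub`), and the area becomes the line integral of (1 - h) dφ, with h
the height and φ the longitude (`areaAvoiding_eq_sum`).

Half of this integral along one side is an argument of an elementary function of its starting corner
and midpoint (`exp_areaContribution`, `transport_len`). Write σ_v for the Pauli matrix of v, and ψ_a
= (1 + h(a), z(a)) with z the horizontal part, so that σ_a ψ_a = ψ_a. The function is the conjugate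
of the first component of σ_m ψ_a, and σ_m ψ_a is proportional to ψ_b. The product over the three
sides is therefore governed by σ_β σ_α σ_γ = k σ_a - i det, which acts on ψ_a as k - i det
(`spinor_product`). Conjugating yields e^{iΩ/2} = k + i det, in which the exterior point no longer
appears. -/

open scoped ComplexConjugate Pointwise
open MeasureTheory

/-! ### Surface measure: invariance, total mass, null points. -/

/-- The surface measure of the unit sphere. -/
noncomputable abbrev surfaceMeasure : Measure S2 := (volume : Measure E3).toSphere

/-- The action of a linear isometry on the unit sphere. -/
noncomputable def sphereIsometry (g : E3 ≃ₗᵢ[ℝ] E3) : S2 ≃ᵐ S2 where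
  toFun x := ⟨g x, by simp⟩
  invFun x := ⟨g.symm x, by simp⟩
  left_inv x := by simp
  right_inv x := by simp
  measurable_toFun := by
    exact (Continuous.subtype_mk (g.continuous.comp continuous_subtype_val) _).measurable
  measurable_invFun := by
    exact (Continuous.subtype_mk (g.symm.continuous.comp continuous_subtype_val) _).measurable

@[simp]
lemma coe_sphereIsometry (g : E3 ≃ₗᵢ[ℝ] E3) (x : S2) : (sphereIsometry g x : E3) = g x := rfl

/-- The surface measure of a set is a multiple of the volume of the cone over it, and a linear
isometry commutes with forming cones. -/
lemma measurePreserving_sphereIsometry (g : E3 ≃ₗᵢ[ℝ] E3) :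
    MeasurePreserving (sphereIsometry g) surfaceMeasure surfaceMeasure := by
  refine ⟨(sphereIsometry g).measurable, ?_⟩
  ext s hs
  rw [Measure.map_apply (sphereIsometry g).measurable hs, Measure.toSphere_apply' _ hs,
    Measure.toSphere_apply' _ ((sphereIsometry g).measurable hs)]
  have : Set.Ioo (0 : ℝ) 1 • ((↑) '' ((sphereIsometry g) ⁻¹' s) : Set E3) =
      g ⁻¹' (Set.Ioo (0 : ℝ) 1 • ((↑) '' s : Set E3)) := by
    ext y
    simp only [Set.mem_smul, Set.mem_image, Set.mem_preimage]
    constructor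
    · rintro ⟨r, hr, _, ⟨x, hx, rfl⟩, rfl⟩
      exact ⟨r, hr, _, ⟨_, hx, rfl⟩, by simp⟩
    · rintro ⟨r, hr, _, ⟨x, hx, rfl⟩, h⟩
      refine ⟨r, hr, _, ⟨(sphereIsometry g).symm x, by simpa using hx, rfl⟩, ?_⟩
      apply g.injective
      rw [← h, map_smul]
      congr 1
      exact congrArg Subtype.val ((sphereIsometry g).apply_symm_apply x)
  rw [this]
  congr 1
  exact (g.measurePreserving).measure_preimage_emb g.toMeasurableEquiv.measurableEmbedding _

lemma surfaceMeasure_univ : surfaceMeasure.real Set.univ = 4 * Real.pi := by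
  rw [Measure.toSphere_real_apply_univ, measureReal_def, EuclideanSpace.volume_ball_fin_three]
  rw [ENNReal.toReal_mul, ENNReal.toReal_ofReal (by positivity)]
  simp
  ring

instance : NullSingletonClass surfaceMeasure where
  measure_singleton x := by
    rw [Measure.toSphere_apply' _ (measurableSet_singleton x)]
    suffices h : volume (Set.Ioo (0 : ℝ) 1 • ((↑) '' ({x} : Set S2) : Set E3)) = 0 by
      rw [h, mul_zero]
    refine measure_mono_null ?_ (Measure.addHaar_submodule volume (ℝ ∙ (x : E3)) ?_)
    · rintro _ ⟨r, -, _, ⟨y, hy, rfl⟩, rfl⟩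
      rw [Set.mem_singleton_iff.1 hy]
      exact Submodule.smul_mem _ _ (Submodule.mem_span_singleton_self _)
    · intro h
      have h1 := finrank_span_le_card (R := ℝ) ({(x : E3)} : Set E3)
      rw [h, finrank_top] at h1
      simp at h1

/-! ### Integrability of the reciprocal sine of the distance to an axis. -/

lemma integrable_abs_rpow_indicator :
    Integrable (Set.indicator (Set.Ioo (-1) 1) fun s : ℝ ↦ |s| ^ (-(1 / 2) : ℝ)) := by
  rw [integrable_indicator_iff measurableSet_Ioo]
  have h1 : IntervalIntegrable (fun s : ℝ ↦ |s| ^ (-(1 / 2) : ℝ)) volume 0 1 := by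
    refine (intervalIntegral.intervalIntegrable_rpow' (r := -(1 / 2)) (by norm_num)).congr ?_
    intro s hs
    rw [Set.uIoc_of_le zero_le_one] at hs
    simp [abs_of_pos hs.1]
  have h2 : IntervalIntegrable (fun s : ℝ ↦ |s| ^ (-(1 / 2) : ℝ)) volume (-1) 0 := by
    rw [← neg_zero, IntervalIntegrable.iff_comp_neg]
    simpa using h1.symm
  have h3 := h2.trans h1
  rw [intervalIntegrable_iff_integrableOn_Ioo_of_le (by norm_num)] at h3
  exact h3

/-- A singular majorant on the ball that is a product of functions of the coordinates. -/
noncomputable def coordMajorant (i : Fin 3) : ℝ → ℝ :=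
  if i = 2 then Set.indicator (Set.Ioo (-1) 1) 1 else
    Set.indicator (Set.Ioo (-1) 1) fun s : ℝ ↦ |s| ^ (-(1 / 2) : ℝ)

lemma integrable_prod_coordMajorant :
    Integrable (fun y : E3 ↦ ∏ i, coordMajorant i (y i)) := by
  have h : Integrable (fun y : Fin 3 → ℝ ↦ ∏ i, coordMajorant i (y i))
      (Measure.pi fun _ ↦ volume) := by
    refine Integrable.fintype_prod fun i ↦ ?_
    unfold coordMajorant
    split_ifs
    · rw [integrable_indicator_iff measurableSet_Ioo]
      exact integrableOn_const (by simp)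
    · exact integrable_abs_rpow_indicator
  exact ((PiLp.volume_preserving_ofLp (Fin 3)).integrable_comp_emb
    (MeasurableEquiv.toLp 2 (Fin 3 → ℝ)).symm.measurableEmbedding).2 h

/-- By AM-GM, |y₀||y₁| ≤ y₀² + y₁²; this separates the variables, so that Fubini applies to the
majorant. -/
lemma inv_sqrt_le_prod_coordMajorant {y : E3} {c : ℝ} (hy : ‖y‖ < 1) (h0 : y 0 ≠ 0) (h1 : y 1 ≠ 0)
    (hc : y 0 ^ 2 + y 1 ^ 2 ≤ c) : (√c)⁻¹ ≤ ∏ i, coordMajorant i (y i) := by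
  have hmem : ∀ i, y i ∈ Set.Ioo (-1 : ℝ) 1 := fun i ↦ by
    have := (PiLp.norm_apply_le y i).trans_lt hy
    rwa [Real.norm_eq_abs, abs_lt] at this
  have p0 := abs_pos.2 h0
  have p1 := abs_pos.2 h1
  have hm : |y 0| ^ (-(1 / 2) : ℝ) * |y 1| ^ (-(1 / 2) : ℝ) = (√(|y 0| * |y 1|))⁻¹ := by
    rw [← Real.mul_rpow p0.le p1.le, Real.sqrt_eq_rpow, ← Real.rpow_neg (by positivity)]
  have hp : ∏ i, coordMajorant i (y i) = (√(|y 0| * |y 1|))⁻¹ := by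
    rw [← hm, Fin.prod_univ_three, coordMajorant, coordMajorant, coordMajorant,
      if_neg (by decide), if_neg (by decide), if_pos rfl, Set.indicator_of_mem (hmem 0),
      Set.indicator_of_mem (hmem 1), Set.indicator_of_mem (hmem 2), Pi.one_apply, mul_one]
  rw [hp]
  gcongr
  refine le_trans ?_ hc
  nlinarith [sq_abs (y 0), sq_abs (y 1), sq_nonneg (|y 0| - |y 1|)]

lemma ae_coord_ne_zero (i : Fin 3) : ∀ᵐ y : E3, y i ≠ 0 := by
  have h : ∀ᵐ y : Fin 3 → ℝ, y i ≠ 0 := Measure.ae_eval_ne (fun _ ↦ volume) i 0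
  exact (PiLp.volume_preserving_ofLp (Fin 3)).quasiMeasurePreserving.ae h

/-- In polar coordinates the integral over the unit ball is the one over the sphere times a positive
constant, so finiteness may be tested on the ball. There y = r x with r < 1 satisfies y₀² + y₁² ≤ 1
- x₂², and the product majorant applies. -/
lemma lintegral_inv_sqrt_coord_lt_top :
    ∫⁻ x, ENNReal.ofReal (√(1 - (x : E3) 2 ^ 2))⁻¹ ∂surfaceMeasure < ⊤ := by
  set φ : S2 → ENNReal := fun x ↦ ENNReal.ofReal (√(1 - (x : E3) 2 ^ 2))⁻¹ with hφ
  have hφm : Measurable φ := by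
    have : Continuous fun x : S2 ↦ (x : E3) 2 := by fun_prop
    have := this.measurable
    fun_prop
  set ν := Measure.volumeIoiPow (Module.finrank ℝ E3 - 1)
  set I : Set (Set.Ioi (0 : ℝ)) := Set.Iio ⟨1, Set.mem_Ioi.2 one_pos⟩
  have hν : ν I ≠ 0 := by
    rw [Measure.volumeIoiPow_apply_Iio]
    simp
    positivity
  have hprod : ∫⁻ z, φ z.1 * I.indicator 1 z.2 ∂(surfaceMeasure.prod ν) =
      (∫⁻ x, φ x ∂surfaceMeasure) * ν I := by
    rw [lintegral_prod_mul hφm.aemeasurable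
      (measurable_one.indicator measurableSet_Iio).aemeasurable,
      lintegral_indicator_one measurableSet_Iio]
  have hle : ∫⁻ z, φ z.1 * I.indicator 1 z.2 ∂(surfaceMeasure.prod ν) ≤
      ∫⁻ y : E3, ENNReal.ofReal (∏ i, coordMajorant i (y i)) := by
    have hm : Measurable fun z : S2 × Set.Ioi (0 : ℝ) ↦ φ z.1 * I.indicator 1 z.2 :=
      (hφm.comp measurable_fst).mul
        ((measurable_one.indicator measurableSet_Iio).comp measurable_snd)
    rw [← (volume.measurePreserving_homeomorphUnitSphereProd (E := E3)).lintegral_comp hm]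
    refine le_trans ?_ (setLIntegral_le_lintegral {0}ᶜ _)
    rw [← lintegral_subtype_comap (measurableSet_singleton _).compl]
    refine lintegral_mono_ae ?_
    have hae : ∀ i, ∀ᵐ y : ({0}ᶜ : Set E3) ∂(Measure.comap Subtype.val (volume : Measure E3)),
        (y : E3) i ≠ 0 := fun i ↦ by
      have := ae_restrict_of_ae (s := {0}ᶜ) (ae_coord_ne_zero i)
      rw [← map_comap_subtype_coe (measurableSet_singleton _).compl] at this
      exact ae_of_ae_map measurable_subtype_coe.aemeasurable this
    filter_upwards [hae 0, hae 1] with y h0 h1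
    have hy : 0 < ‖(y : E3)‖ := norm_pos_iff.2 y.2
    by_cases hlt : ‖(y : E3)‖ < 1
    · have : (homeomorphUnitSphereProd E3 y).2 ∈ I := by
        rw [Set.mem_Iio, ← Subtype.coe_lt_coe]
        simpa using hlt
      rw [Set.indicator_of_mem this, Pi.one_apply, mul_one]
      refine ENNReal.ofReal_le_ofReal (inv_sqrt_le_prod_coordMajorant hlt h0 h1 ?_)
      have hn : ‖(y : E3)‖ ^ 2 = (y : E3) 0 ^ 2 + (y : E3) 1 ^ 2 + (y : E3) 2 ^ 2 := by
        rw [EuclideanSpace.norm_sq_eq]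
        simp [Fin.sum_univ_three]
      have h2 : ((homeomorphUnitSphereProd E3 y).1 : E3) 2 = ‖(y : E3)‖⁻¹ * (y : E3) 2 := by
        simp
      have h3 : (‖(y : E3)‖⁻¹ * (y : E3) 2) ^ 2 * ‖(y : E3)‖ ^ 2 = (y : E3) 2 ^ 2 := by
        field_simp
      have h4 : (y : E3) 2 ^ 2 ≤ ‖(y : E3)‖ ^ 2 := by
        rw [hn]; nlinarith [sq_nonneg ((y : E3) 0), sq_nonneg ((y : E3) 1)]
      have h5 : (‖(y : E3)‖⁻¹ * (y : E3) 2) ^ 2 ≤ 1 := by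
        rw [mul_pow, inv_pow, inv_mul_le_one₀ (by positivity)]; exact h4
      have h6 : ‖(y : E3)‖ ^ 2 ≤ 1 := pow_le_one₀ hy.le hlt.le
      rw [h2]
      nlinarith [mul_nonneg (sub_nonneg.2 h5) (sub_nonneg.2 h6)]
    · have : (homeomorphUnitSphereProd E3 y).2 ∉ I := by
        rw [Set.mem_Iio, ← Subtype.coe_lt_coe]
        simpa using hlt
      simp [Set.indicator_of_notMem this]
  rw [hprod] at hle
  have hfin := hle.trans_lt (integrable_prod_coordMajorant.lintegral_lt_top)
  by_contra h
  rw [not_lt_top_iff] at h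
  rw [h, ENNReal.top_mul hν] at hfin
  exact lt_irrefl _ hfin

lemma exists_orthonormalBasis_apply_two (p : S2) :
    ∃ b : OrthonormalBasis (Fin 3) ℝ E3, b 2 = p := by
  have : Orthonormal ℝ (({2} : Set (Fin 3)).domRestrict fun _ ↦ (p : E3)) := by
    constructor
    · intro i; exact norm_eq_of_mem_sphere p
    · intro i j hij; exact absurd (Subsingleton.elim i j) hij
  obtain ⟨b, hb⟩ := this.exists_orthonormalBasis_extension_of_card_eq (by simp)
  exact ⟨b, hb 2 rfl⟩

/-- The integral of `1 / sin` of the distance from the axis through a point. -/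
noncomputable def axisIntegral : ℝ := ∫ x, (√(1 - (x : E3) 2 ^ 2))⁻¹ ∂surfaceMeasure

lemma integrable_inv_sqrt_coord :
    Integrable (fun x : S2 ↦ (√(1 - (x : E3) 2 ^ 2))⁻¹) surfaceMeasure := by
  have : Continuous fun x : S2 ↦ (x : E3) 2 := by fun_prop
  have := this.measurable
  refine ⟨by fun_prop, ?_⟩
  rw [hasFiniteIntegral_iff_ofReal (.of_forall fun x ↦ by positivity)]
  exact lintegral_inv_sqrt_coord_lt_top

lemma integrable_inv_sqrt_inner (p : S2) :
    Integrable (fun x : S2 ↦ (√(1 - ⟪(p : E3), x⟫ ^ 2))⁻¹) surfaceMeasure ∧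
      ∫ x : S2, (√(1 - ⟪(p : E3), x⟫ ^ 2))⁻¹ ∂surfaceMeasure = axisIntegral := by
  obtain ⟨b, hb⟩ := exists_orthonormalBasis_apply_two p
  have hmp := measurePreserving_sphereIsometry b.repr
  have hx : (fun x : S2 ↦ (√(1 - ⟪(p : E3), x⟫ ^ 2))⁻¹) =
      (fun x : S2 ↦ (√(1 - (x : E3) 2 ^ 2))⁻¹) ∘ sphereIsometry b.repr := by
    ext x
    simp [b.repr_apply_apply, hb]
  constructor
  · rw [hx]
    exact (hmp.integrable_comp_emb (MeasurableEquiv.measurableEmbedding _)).2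
      integrable_inv_sqrt_coord
  · rw [hx]
    exact hmp.integral_comp' fun x : S2 ↦ (√(1 - (x : E3) 2 ^ 2))⁻¹

/-! ### Cauchy transform of the surface measure. -/

/-- The horizontal part of a vector with respect to an orthonormal basis, as a complex number. -/
noncomputable def planePart (e : OrthonormalBasis (Fin 3) ℝ E3) (x : E3) : ℂ :=
  (⟪e 0, x⟫ : ℂ) + (⟪e 1, x⟫ : ℂ) * Complex.I

lemma stereo_eq_div (e : OrthonormalBasis (Fin 3) ℝ E3) (x : E3) :
    stereo e x = planePart e x / (1 + (⟪e 2, x⟫ : ℂ)) := rfl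

lemma inner_eq_coord (e : OrthonormalBasis (Fin 3) ℝ E3) (u v : E3) :
    ⟪u, v⟫ = ⟪e 0, u⟫ * ⟪e 0, v⟫ + ⟪e 1, u⟫ * ⟪e 1, v⟫ + ⟪e 2, u⟫ * ⟪e 2, v⟫ := by
  rw [← e.sum_inner_mul_inner u v, Fin.sum_univ_three]
  simp only [real_inner_comm u]

@[simp]
lemma inner_self_sphere (x : S2) : ⟪(x : E3), (x : E3)⟫ = 1 := by
  rw [real_inner_self_eq_norm_sq, norm_eq_of_mem_sphere]; norm_num

lemma coord_sq_sum (e : OrthonormalBasis (Fin 3) ℝ E3) (x : S2) :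
    ⟪e 0, (x : E3)⟫ ^ 2 + ⟪e 1, (x : E3)⟫ ^ 2 + ⟪e 2, (x : E3)⟫ ^ 2 = 1 := by
  have h := inner_self_sphere x
  rw [inner_eq_coord e] at h
  linarith

lemma planePart_mul_conj (e : OrthonormalBasis (Fin 3) ℝ E3) (x : S2) :
    planePart e x * conj (planePart e x) = 1 - (⟪e 2, (x : E3)⟫ : ℂ) ^ 2 := by
  have h := congrArg Complex.ofReal (coord_sq_sum e x)
  push_cast at h
  simp only [planePart, map_add, map_mul, Complex.conj_ofReal, Complex.conj_I]
  linear_combination h - (⟪e 1, (x : E3)⟫ : ℂ) ^ 2 * Complex.I_sq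

lemma inner_eq_planePart (e : OrthonormalBasis (Fin 3) ℝ E3) (u v : E3) :
    (⟪u, v⟫ : ℂ) = (planePart e u * conj (planePart e v) + conj (planePart e u) * planePart e v) / 2
      + ⟪e 2, u⟫ * ⟪e 2, v⟫ := by
  rw [inner_eq_coord e]
  simp only [planePart, map_add, map_mul, Complex.conj_ofReal, Complex.conj_I]
  push_cast
  linear_combination (⟪e 1, u⟫ : ℂ) * (⟪e 1, v⟫ : ℂ) * Complex.I_sq

/-- The numerator of the odd part of the Cauchy kernel on the sphere. -/
noncomputable def kernelNum (e : OrthonormalBasis (Fin 3) ℝ E3) (p x : E3) : ℂ :=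
  conj (planePart e p) * (⟪e 2, x⟫ + ⟪p, x⟫) - conj (planePart e x) * (1 + ⟪e 2, p⟫)

lemma norm_kernelNum_sq (e : OrthonormalBasis (Fin 3) ℝ E3) (p x : S2) :
    ‖kernelNum e p x‖ ^ 2 = (1 + ⟪e 2, (p : E3)⟫) ^ 2 * (1 - ⟪(p : E3), x⟫ ^ 2) := by
  have hp := planePart_mul_conj e p
  have hx := planePart_mul_conj e x
  have hc := inner_eq_planePart e p x
  rw [← Complex.ofReal_inj, ← Complex.normSq_eq_norm_sq, ← Complex.mul_conj, kernelNum]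
  simp only [map_sub, map_add, map_mul, Complex.conj_ofReal, Complex.conj_conj, map_one]
  push_cast
  linear_combination ((⟪e 2, (x : E3)⟫ : ℂ) + ⟪(p : E3), x⟫) ^ 2 * hp +
    (1 + (⟪e 2, (p : E3)⟫ : ℂ)) ^ 2 * hx +
    2 * ((⟪e 2, (x : E3)⟫ : ℂ) + ⟪(p : E3), x⟫) * (1 + (⟪e 2, (p : E3)⟫ : ℂ)) * hc

lemma abs_inner_le_one (p x : S2) : |⟪(p : E3), (x : E3)⟫| ≤ 1 := by
  simpa using abs_real_inner_le_norm (p : E3) (x : E3)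

lemma inner_lt_one_of_ne {p x : S2} (h : p ≠ x) : ⟪(p : E3), (x : E3)⟫ < 1 := by
  refine lt_of_le_of_ne (abs_le.1 (abs_inner_le_one p x)).2 fun h1 ↦ h ?_
  exact Subtype.ext ((inner_eq_one_iff_of_norm_eq_one (by simp) (by simp)).1 h1)

lemma norm_basis_neg (e : OrthonormalBasis (Fin 3) ℝ E3) : -e 2 ∈ Metric.sphere (0 : E3) 1 := by
  simp

lemma one_add_height_pos (e : OrthonormalBasis (Fin 3) ℝ E3) {x : S2} (hx : (x : E3) ≠ -e 2) :
    0 < 1 + ⟪e 2, (x : E3)⟫ := by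
  have h := inner_lt_one_of_ne (p := ⟨-e 2, norm_basis_neg e⟩) (x := x)
    (fun h ↦ hx (congrArg Subtype.val h).symm)
  simp only [inner_neg_left] at h
  linarith

/-- The Cauchy kernel is split, as a function of x, into a part that is odd under the half-turn
about p and a constant, which is its mean over the sphere. -/
lemma inv_stereo_sub (e : OrthonormalBasis (Fin 3) ℝ E3) {p x : S2} (hp : (p : E3) ≠ -e 2)
    (hx : (x : E3) ≠ -e 2) (hpx : p ≠ x) :
    (stereo e p - stereo e x)⁻¹ =
      kernelNum e p x / (2 * (1 - ⟪(p : E3), x⟫)) + conj (planePart e p) / 2 := by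
  have h1 := inner_lt_one_of_ne hpx
  have hp0 : (1 + (⟪e 2, (p : E3)⟫ : ℂ)) ≠ 0 := by
    exact_mod_cast (one_add_height_pos e hp).ne'
  have hx0 : (1 + (⟪e 2, (x : E3)⟫ : ℂ)) ≠ 0 := by
    exact_mod_cast (one_add_height_pos e hx).ne'
  have hc0 : (1 - (⟪(p : E3), x⟫ : ℂ)) ≠ 0 := by
    exact_mod_cast (sub_pos.2 h1).ne'
  have hpp := planePart_mul_conj e p
  have hxx := planePart_mul_conj e x
  have hc := inner_eq_planePart e p x
  rw [stereo_eq_div, stereo_eq_div, kernelNum]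
  set P := planePart e p
  set X := planePart e x
  set h : ℂ := ((⟪e 2, (p : E3)⟫ : ℝ) : ℂ)
  set H : ℂ := ((⟪e 2, (x : E3)⟫ : ℝ) : ℂ)
  set c : ℂ := ((⟪(p : E3), x⟫ : ℝ) : ℂ)
  apply inv_eq_of_mul_eq_one_right
  field_simp
  linear_combination (1 + H) ^ 2 * hpp + (1 + h) ^ 2 * hxx + 2 * (1 + h) * (1 + H) * hc

/-- With c = ⟪p, x⟫ and h the height of p, `norm_kernelNum_sq` makes the left side (1 + h)(1 + c) /
(2√(1 - c²)) away from c = ±1. The bound has the same form for every p, hence an integral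
independent of p. -/
lemma norm_kernel_le (e : OrthonormalBasis (Fin 3) ℝ E3) (p x : S2) :
    ‖kernelNum e p x / (2 * (1 - ⟪(p : E3), x⟫))‖ ≤ 2 * (√(1 - ⟪(p : E3), x⟫ ^ 2))⁻¹ := by
  have hN := norm_kernelNum_sq e p x
  obtain ⟨hc1, hc2⟩ := abs_le.1 (abs_inner_le_one p x)
  have hq : |1 + ⟪e 2, (p : E3)⟫| ≤ 2 := by
    have := abs_real_inner_le_norm (e 2) (p : E3)
    simp at this
    rw [abs_le] at this ⊢
    constructor <;> linarith
  set c := ⟪(p : E3), x⟫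
  -- At c = 1 both sides are 0, as division by zero gives 0; at c = -1 the numerator vanishes.
  rcases hc2.eq_or_lt with hc | hc
  · simp [hc]
  rcases hc1.eq_or_lt with hd | hd
  · rw [← hd] at hN ⊢
    simp at hN
    simp [hN]
  have hs : 0 < 1 - c ^ 2 := by nlinarith
  have hn : ‖kernelNum e p x‖ ≤ 2 * √(1 - c ^ 2) := by
    refine le_of_sq_le_sq ?_ (by positivity)
    rw [hN, mul_pow, Real.sq_sqrt hs.le]
    refine mul_le_mul_of_nonneg_right ?_ hs.le
    rw [← sq_abs (1 + _)]
    exact pow_le_pow_left₀ (abs_nonneg _) hq 2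
  have hd2 : ‖(2 * (1 - (c : ℂ)))‖ = 2 * (1 - c) := by
    rw [← Complex.ofReal_one, ← Complex.ofReal_sub, norm_mul, Complex.norm_real,
      Real.norm_of_nonneg (by linarith)]
    simp
  rw [norm_div, hd2, div_le_iff₀ (by linarith)]
  refine hn.trans ?_
  have hsq : (√(1 - c ^ 2))⁻¹ = √(1 - c ^ 2) / (1 - c ^ 2) := by
    rw [eq_div_iff hs.ne']
    nth_rewrite 2 [← Real.sq_sqrt hs.le]
    field_simp
  rw [hsq]
  have : 1 - c ^ 2 = (1 - c) * (1 + c) := by ring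
  rw [this, mul_div_assoc', div_mul_eq_mul_div, le_div_iff₀ (by nlinarith)]
  have := Real.sqrt_nonneg ((1 - c) * (1 + c))
  nlinarith [mul_nonneg this (sub_nonneg.2 hc2)]

lemma measurable_kernel (e : OrthonormalBasis (Fin 3) ℝ E3) (p : S2) :
    Measurable fun x : S2 ↦ kernelNum e p x / (2 * (1 - (⟪(p : E3), x⟫ : ℂ))) := by
  have hN : Continuous fun x : S2 ↦ kernelNum e p x := by
    unfold kernelNum planePart; fun_prop
  have hD : Continuous fun x : S2 ↦ (2 * (1 - (⟪(p : E3), x⟫ : ℂ))) := by fun_prop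
  exact hN.measurable.div hD.measurable

lemma integrable_kernel (e : OrthonormalBasis (Fin 3) ℝ E3) (p : S2) :
    Integrable (fun x : S2 ↦ kernelNum e p x / (2 * (1 - (⟪(p : E3), x⟫ : ℂ)))) surfaceMeasure :=
  Integrable.mono' ((integrable_inv_sqrt_inner p).1.const_mul 2)
    (measurable_kernel e p).aestronglyMeasurable (.of_forall (norm_kernel_le e p))

/-- The half-turn about p preserves the measure and ⟪p, x⟫ but changes the sign of the numerator. -/
lemma integral_kernel (e : OrthonormalBasis (Fin 3) ℝ E3) (p : S2) :
    ∫ x : S2, kernelNum e p x / (2 * (1 - (⟪(p : E3), x⟫ : ℂ))) ∂surfaceMeasure = 0 := by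
  set f : S2 → ℂ := fun x ↦ kernelNum e p x / (2 * (1 - (⟪(p : E3), x⟫ : ℂ)))
  set ρ := Submodule.reflection (ℝ ∙ (p : E3))
  have hρ : ∀ x : S2, f (sphereIsometry ρ x) = -f x := fun x ↦ by
    have h : (ρ x : E3) = (2 * ⟪(p : E3), x⟫) • (p : E3) - x := by
      simp only [ρ, Submodule.reflection_singleton_apply]
      simp [two_smul, two_mul, add_smul]
    simp only [f, coe_sphereIsometry, h, kernelNum, planePart, inner_sub_right, inner_smul_right,
      inner_self_sphere]
    rw [show 2 * ⟪(p : E3), x⟫ * 1 - ⟪(p : E3), x⟫ = ⟪(p : E3), x⟫ by ring, ← neg_div]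
    congr 1
    simp only [map_add, map_mul, Complex.conj_ofReal, Complex.conj_I]
    push_cast
    ring
  have h := (measurePreserving_sphereIsometry ρ).integral_comp' f
  simp only [hρ] at h
  rw [integral_neg] at h
  exact self_eq_neg.1 h.symm

lemma ae_inv_stereo_sub (e : OrthonormalBasis (Fin 3) ℝ E3) {p : S2} (hp : (p : E3) ≠ -e 2) :
    (fun x : S2 ↦ (stereo e p - stereo e x)⁻¹) =ᵐ[surfaceMeasure] fun x ↦
      kernelNum e p x / (2 * (1 - ⟪(p : E3), x⟫)) + conj (planePart e p) / 2 := by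
  have h1 : ∀ᵐ x ∂surfaceMeasure, x ≠ p := compl_mem_ae_iff.2 (measure_singleton p)
  have h2 : ∀ᵐ x ∂surfaceMeasure, x ≠ ⟨-e 2, norm_basis_neg e⟩ :=
    compl_mem_ae_iff.2 (measure_singleton _)
  filter_upwards [h1, h2] with x h1 h2
  exact inv_stereo_sub e hp (fun h ↦ h2 (Subtype.ext h)) h1.symm

/-- The Cauchy transform of the surface measure in the stereographic coordinate. -/
lemma integral_inv_stereo_sub (e : OrthonormalBasis (Fin 3) ℝ E3) {p : S2} (hp : (p : E3) ≠ -e 2) :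
    Integrable (fun x : S2 ↦ (stereo e p - stereo e x)⁻¹) surfaceMeasure ∧
    ∫ x : S2, (stereo e p - stereo e x)⁻¹ ∂surfaceMeasure =
      2 * Real.pi * conj (planePart e p) ∧
    ∫ x : S2, ‖(stereo e p - stereo e x)⁻¹‖ ∂surfaceMeasure ≤ 2 * axisIntegral + 2 * Real.pi := by
  have hae := ae_inv_stereo_sub e hp
  have hint := (integrable_kernel e p).add
    (integrable_const (μ := surfaceMeasure) (conj (planePart e p) / 2))
  refine ⟨hint.congr hae.symm, ?_, ?_⟩
  · rw [integral_congr_ae hae, integral_add (integrable_kernel e p) (integrable_const _),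
      integral_kernel, integral_const, surfaceMeasure_univ, zero_add, Complex.real_smul]
    push_cast
    ring
  · have hbd : ‖conj (planePart e p) / 2‖ ≤ 1 / 2 := by
      rw [norm_div, RCLike.norm_conj]
      have : ‖planePart e p‖ ≤ 1 := by
        refine (sq_le_one_iff₀ (norm_nonneg _)).1 ?_
        have h := planePart_mul_conj e p
        rw [Complex.mul_conj, Complex.normSq_eq_norm_sq] at h
        have h' : ‖planePart e p‖ ^ 2 = 1 - ⟪e 2, (p : E3)⟫ ^ 2 := by exact_mod_cast h
        rw [h']
        nlinarith [sq_nonneg ⟪e 2, (p : E3)⟫]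
      simp only [Complex.norm_ofNat]
      linarith
    have hi := ((integrable_inv_sqrt_inner p).1.const_mul 2).add
      (integrable_const (μ := surfaceMeasure) (1 / 2 : ℝ))
    calc _ ≤ ∫ x : S2, (2 * (√(1 - ⟪(p : E3), x⟫ ^ 2))⁻¹ + 1 / 2) ∂surfaceMeasure := by
          refine integral_mono_ae (hint.congr hae.symm).norm hi ?_
          filter_upwards [hae] with x hx
          rw [hx]
          exact (norm_add_le _ _).trans (add_le_add (norm_kernel_le e p x) hbd)
      _ = _ := by
          rw [integral_add ((integrable_inv_sqrt_inner p).1.const_mul 2) (integrable_const _),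
            integral_const_mul, (integrable_inv_sqrt_inner p).2, integral_const,
            surfaceMeasure_univ, smul_eq_mul]
          ring

/-! ### The area as a line integral along the sides. -/

namespace GeodesicSegment

variable (s : GeodesicSegment) (e : OrthonormalBasis (Fin 3) ℝ E3)

lemma norm_point (t : ℝ) : ‖s.point t‖ = 1 := by
  have h : ‖s.point t‖ ^ 2 = 1 := by
    rw [← real_inner_self_eq_norm_sq, point]
    simp only [inner_add_left, inner_add_right, inner_smul_left, inner_smul_right,
      inner_self_sphere, s.inner_start_dir, real_inner_comm (s.start : E3) s.dir,
      real_inner_self_eq_norm_sq s.dir, s.norm_dir]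
    simp
    nlinarith [Real.sin_sq_add_cos_sq t]
  exact (pow_eq_one_iff_of_nonneg (norm_nonneg _) two_ne_zero).1 h

lemma point_mem_sphere (t : ℝ) : s.point t ∈ Metric.sphere (0 : E3) 1 := by
  simp [s.norm_point]

/-- The velocity of the parametrisation by arc length. -/
noncomputable def velocity (t : ℝ) : E3 := -Real.sin t • (s.start : E3) + Real.cos t • s.dir

lemma inner_point (v : E3) (t : ℝ) :
    ⟪v, s.point t⟫ = Real.cos t * ⟪v, (s.start : E3)⟫ + Real.sin t * ⟪v, s.dir⟫ := by
  simp only [point, inner_add_right, inner_smul_right]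

lemma inner_velocity (v : E3) (t : ℝ) :
    ⟪v, s.velocity t⟫ = -Real.sin t * ⟪v, (s.start : E3)⟫ + Real.cos t * ⟪v, s.dir⟫ := by
  simp only [velocity, inner_add_right, inner_smul_right]

lemma hasDerivAt_inner_point (v : E3) (t : ℝ) :
    HasDerivAt (fun r ↦ ⟪v, s.point r⟫) ⟪v, s.velocity t⟫ t := by
  simp only [inner_point, inner_velocity]
  exact ((Real.hasDerivAt_cos t).mul_const _).add ((Real.hasDerivAt_sin t).mul_const _)

lemma hasDerivAt_planePart_point (t : ℝ) :
    HasDerivAt (fun r ↦ planePart e (s.point r)) (planePart e (s.velocity t)) t := by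
  unfold planePart
  exact (s.hasDerivAt_inner_point _ t).ofReal_comp.add
    ((s.hasDerivAt_inner_point _ t).ofReal_comp.mul_const _)

@[fun_prop]
lemma continuous_point : Continuous s.point := by unfold point; fun_prop

@[fun_prop]
lemma continuous_velocity : Continuous s.velocity := by unfold velocity; fun_prop

lemma continuous_planePart : Continuous (planePart e) := by unfold planePart; fun_prop

variable {s e}

lemma one_add_height_point_pos (hs : -e 2 ∉ s.carrier) {t : ℝ} (ht : t ∈ Set.Icc 0 s.len) :
    0 < 1 + ⟪e 2, s.point t⟫ :=
  one_add_height_pos e (x := ⟨s.point t, s.point_mem_sphere t⟩)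
    fun h ↦ hs ⟨t, ht, h⟩

lemma hasDerivAt_stereo_point (hs : -e 2 ∉ s.carrier) {t : ℝ} (ht : t ∈ Set.Icc 0 s.len) :
    HasDerivAt (fun r ↦ stereo e (s.point r))
      ((planePart e (s.velocity t) * (1 + (⟪e 2, s.point t⟫ : ℂ)) -
        planePart e (s.point t) * (⟪e 2, s.velocity t⟫ : ℂ)) /
          (1 + (⟪e 2, s.point t⟫ : ℂ)) ^ 2) t :=
  (s.hasDerivAt_planePart_point e t).div
    ((s.hasDerivAt_inner_point (e 2) t).ofReal_comp.const_add 1)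
    (by exact_mod_cast (one_add_height_point_pos hs ht).ne')

lemma continuousOn_deriv_stereo_point (hs : -e 2 ∉ s.carrier) :
    ContinuousOn (fun t ↦ deriv (fun r ↦ stereo e (s.point r)) t) (Set.Icc 0 s.len) := by
  have hP := continuous_planePart e
  refine ContinuousOn.congr (f := fun t ↦
    ((planePart e (s.velocity t) * (1 + (⟪e 2, s.point t⟫ : ℂ)) -
      planePart e (s.point t) * (⟪e 2, s.velocity t⟫ : ℂ)) /
        (1 + (⟪e 2, s.point t⟫ : ℂ)) ^ 2)) ?_
    fun t ht ↦ (hasDerivAt_stereo_point hs ht).deriv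
  refine ContinuousOn.div (by fun_prop) (by fun_prop) fun t ht ↦ pow_ne_zero 2 ?_
  exact_mod_cast (one_add_height_point_pos hs ht).ne'

lemma measurable_stereo : Measurable (stereo e) := by
  have h1 : Continuous fun x : E3 ↦ (1 + (⟪e 2, x⟫ : ℂ)) := by fun_prop
  exact (continuous_planePart e).measurable.div h1.measurable

/-- Justifies Fubini. The L¹ norm of the Cauchy kernel is bounded uniformly in its pole, and the
stereographic velocity is bounded because the compact segment misses the exterior point. -/
lemma integrable_cauchyKernel (hs : -e 2 ∉ s.carrier) :
    Integrable (Function.uncurry fun (t : ℝ) (x : S2) ↦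
      deriv (fun r : ℝ ↦ stereo e (s.point r)) t / (stereo e (s.point t) - stereo e x))
      ((volume.restrict (Set.uIoc 0 s.len)).prod surfaceMeasure) := by
  rw [Set.uIoc_of_le s.len_nonneg]
  have hst := measurable_stereo (e := e)
  have hmeas : Measurable (Function.uncurry fun (t : ℝ) (x : S2) ↦
      deriv (fun r : ℝ ↦ stereo e (s.point r)) t / (stereo e (s.point t) - stereo e x)) := by
    refine Measurable.div ((measurable_deriv _).comp measurable_fst) (Measurable.sub ?_ ?_)
    · exact hst.comp (s.continuous_point.measurable.comp measurable_fst)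
    · exact hst.comp (measurable_subtype_coe.comp measurable_snd)
  have hne : ∀ t ∈ Set.Ioc 0 s.len, s.point t ≠ -e 2 := fun t ht h ↦
    hs ⟨t, Set.Ioc_subset_Icc_self ht, h⟩
  have hker : ∀ t ∈ Set.Ioc 0 s.len, _ := fun t ht ↦
    integral_inv_stereo_sub e (p := ⟨s.point t, s.point_mem_sphere t⟩) (hne t ht)
  rw [integrable_prod_iff hmeas.aestronglyMeasurable]
  constructor
  · filter_upwards [ae_restrict_mem measurableSet_Ioc] with t ht
    simp only [Function.uncurry_apply_pair, div_eq_mul_inv]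
    exact (hker t ht).1.const_mul _
  · obtain ⟨M, hM⟩ := isCompact_Icc.exists_bound_of_continuousOn
      (continuousOn_deriv_stereo_point hs)
    refine Integrable.mono' (g := fun _ ↦ M * (2 * axisIntegral + 2 * Real.pi))
      (integrable_const _) hmeas.aestronglyMeasurable.norm.integral_prod_right' ?_
    filter_upwards [ae_restrict_mem measurableSet_Ioc] with t ht
    simp only [Function.uncurry_apply_pair, div_eq_mul_inv, norm_mul]
    rw [integral_const_mul, norm_mul, norm_norm,
      Real.norm_of_nonneg (integral_nonneg fun _ ↦ norm_nonneg _)]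
    have h0 := hM t (Set.Ioc_subset_Icc_self ht)
    exact mul_le_mul h0 (hker t ht).2.2 (integral_nonneg fun _ ↦ norm_nonneg _)
      ((norm_nonneg _).trans h0)

lemma integrable_contourIntegral (hs : -e 2 ∉ s.carrier) :
    Integrable (fun x : S2 ↦ s.contourIntegral e (stereo e x)) surfaceMeasure := by
  have h := (integrable_cauchyKernel hs).integral_prod_right
  simpa only [contourIntegral, intervalIntegral.integral_of_le s.len_nonneg,
    Set.uIoc_of_le s.len_nonneg, Function.uncurry_apply_pair] using h

lemma integral_contourIntegral (hs : -e 2 ∉ s.carrier) :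
    ∫ x : S2, s.contourIntegral e (stereo e x) ∂surfaceMeasure =
      ∫ t in (0 : ℝ)..s.len, deriv (fun r : ℝ ↦ stereo e (s.point r)) t *
        (2 * Real.pi * conj (planePart e (s.point t))) := by
  unfold contourIntegral
  rw [← intervalIntegral_integral_swap (integrable_cauchyKernel hs)]
  refine intervalIntegral.integral_congr_ae (.of_forall fun t ht ↦ ?_)
  rw [Set.uIoc_of_le s.len_nonneg] at ht
  simp only [div_eq_mul_inv]
  rw [integral_const_mul]
  congr 1
  exact (integral_inv_stereo_sub e (p := ⟨s.point t, s.point_mem_sphere t⟩)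
    fun h ↦ hs ⟨t, Set.Ioc_subset_Icc_self ht, h⟩).2.1

variable (s e) in
/-- The vertical component of the axis of the great circle carrying a segment. -/
noncomputable def axisHeight : ℝ :=
  ⟪e 0, (s.start : E3)⟫ * ⟪e 1, s.dir⟫ - ⟪e 1, (s.start : E3)⟫ * ⟪e 0, s.dir⟫

variable (s e) in
/-- The contribution of a segment to the oriented area. -/
noncomputable def areaContribution : ℝ :=
  ∫ t in (0 : ℝ)..s.len, s.axisHeight e / (1 + ⟪e 2, s.point t⟫)

/-- With P the horizontal part of the point, the term of the derivative along P contributes a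
multiple of |P|² and becomes purely imaginary after division by i. What remains is the cross product
of P with its velocity, which is constant along a great circle. -/
lemma re_deriv_stereo_mul (hs : -e 2 ∉ s.carrier) {t : ℝ} (ht : t ∈ Set.Icc 0 s.len) :
    (deriv (fun r : ℝ ↦ stereo e (s.point r)) t *
      (2 * Real.pi * conj (planePart e (s.point t))) / (2 * Real.pi * Complex.I)).re =
        s.axisHeight e / (1 + ⟪e 2, s.point t⟫) := by
  have h0 := (one_add_height_point_pos hs ht).ne'
  have h0' : (1 + (⟪e 2, s.point t⟫ : ℂ)) ≠ 0 := by exact_mod_cast h0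
  have hpi : (Real.pi : ℂ) ≠ 0 := by exact_mod_cast Real.pi_ne_zero
  rw [(hasDerivAt_stereo_point hs ht).deriv]
  have hA : s.axisHeight e = ⟪e 0, s.point t⟫ * ⟪e 1, s.velocity t⟫ -
      ⟪e 1, s.point t⟫ * ⟪e 0, s.velocity t⟫ := by
    simp only [inner_point, inner_velocity, axisHeight]
    linear_combination -(⟪e 0, (s.start : E3)⟫ * ⟪e 1, s.dir⟫ -
      ⟪e 1, (s.start : E3)⟫ * ⟪e 0, s.dir⟫) * Real.sin_sq_add_cos_sq t
  have hsq := planePart_mul_conj e ⟨s.point t, s.point_mem_sphere t⟩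
  simp only at hsq
  have : (planePart e (s.velocity t) * (1 + (⟪e 2, s.point t⟫ : ℂ)) -
        planePart e (s.point t) * (⟪e 2, s.velocity t⟫ : ℂ)) /
          (1 + (⟪e 2, s.point t⟫ : ℂ)) ^ 2 * (2 * Real.pi * conj (planePart e (s.point t))) /
          (2 * Real.pi * Complex.I) =
      ((s.axisHeight e / (1 + ⟪e 2, s.point t⟫) : ℝ) : ℂ) -
      Complex.I * ((((⟪e 0, s.point t⟫ * ⟪e 0, s.velocity t⟫ +
        ⟪e 1, s.point t⟫ * ⟪e 1, s.velocity t⟫) - (1 - ⟪e 2, s.point t⟫) * ⟪e 2, s.velocity t⟫) /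
          (1 + ⟪e 2, s.point t⟫) : ℝ) : ℂ) := by
    rw [hA]
    push_cast
    field_simp
    simp only [planePart, map_add, map_mul, Complex.conj_ofReal, Complex.conj_I] at hsq ⊢
    ring_nf at hsq ⊢
    simp only [Complex.I_sq] at hsq ⊢
    linear_combination (-(⟪e 2, s.velocity t⟫ : ℂ)) * hsq
  rw [this, Complex.sub_re, Complex.I_mul_re, Complex.ofReal_im, Complex.ofReal_re]
  simp

end GeodesicSegment

lemma GeodesicSegment.integral_re_contourIntegral {s : GeodesicSegment}
    {e : OrthonormalBasis (Fin 3) ℝ E3} (hs : -e 2 ∉ s.carrier) :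
    ((∫ x : S2, s.contourIntegral e (stereo e x) ∂surfaceMeasure) /
      (2 * Real.pi * Complex.I)).re = s.areaContribution e := by
  have hc : IntervalIntegrable (fun t ↦ deriv (fun r : ℝ ↦ stereo e (s.point r)) t *
      (2 * Real.pi * conj (planePart e (s.point t))) / (2 * Real.pi * Complex.I))
      volume 0 s.len := by
    refine ContinuousOn.intervalIntegrable ?_
    rw [Set.uIcc_of_le s.len_nonneg]
    have h1 := continuousOn_deriv_stereo_point hs
    have h2 : Continuous fun t ↦ conj (planePart e (s.point t)) :=
      Complex.continuous_conj.comp ((continuous_planePart e).comp s.continuous_point)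
    exact (h1.mul (continuous_const.mul h2).continuousOn).div_const _
  rw [integral_contourIntegral hs, ← intervalIntegral.integral_div, areaContribution,
    ← Complex.reCLM_apply, ← Complex.reCLM.intervalIntegral_comp_comm hc]
  refine intervalIntegral.integral_congr fun t ht ↦ ?_
  rw [Set.uIcc_of_le s.len_nonneg] at ht
  exact re_deriv_stereo_mul hs ht

/-- The oriented area as a sum of integrals over the sides. -/
lemma GeodesicTriangle.areaAvoiding_eq_sum {T : GeodesicTriangle}
    {e : OrthonormalBasis (Fin 3) ℝ E3} (he : -e 2 ∉ T.boundary) :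
    T.areaAvoiding e =
      T.ab.areaContribution e + T.bc.areaContribution e + T.ca.areaContribution e := by
  simp only [boundary, Set.mem_union, not_or] at he
  obtain ⟨⟨h1, h2⟩, h3⟩ := he
  have i1 := GeodesicSegment.integrable_contourIntegral h1
  have i2 := GeodesicSegment.integrable_contourIntegral h2
  have i3 := GeodesicSegment.integrable_contourIntegral h3
  have i12 : Integrable (fun x : S2 ↦ T.ab.contourIntegral e (stereo e x) +
    T.bc.contourIntegral e (stereo e x)) surfaceMeasure := i1.add i2
  rw [areaAvoiding, ← GeodesicSegment.integral_re_contourIntegral h1,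
    ← GeodesicSegment.integral_re_contourIntegral h2,
    ← GeodesicSegment.integral_re_contourIntegral h3, ← Complex.add_re, ← Complex.add_re,
    ← add_div, ← add_div, ← integral_add i1 i2, ← integral_add i12 i3, ← integral_div]
  exact integral_re (𝕜 := ℂ) ((i12.add i3).div_const _)

/-! ### Half-angle exponential of the contribution of one side. -/

namespace GeodesicSegment

variable {s : GeodesicSegment} {e : OrthonormalBasis (Fin 3) ℝ E3}

lemma inner_start_point (s : GeodesicSegment) (t : ℝ) :
    ⟪(s.start : E3), s.point t⟫ = Real.cos t := by
  rw [inner_point, inner_self_sphere, s.inner_start_dir]; ring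

lemma finish_eq (s : GeodesicSegment) :
    s.finish = (2 * ⟪(s.start : E3), s.midpoint⟫) • s.midpoint - s.start := by
  rw [midpoint, inner_start_point, finish, point, point, show s.len = 2 * (s.len / 2) by ring,
    Real.cos_two_mul, Real.sin_two_mul, mul_div_cancel_left₀ _ two_ne_zero]
  module

/-- These are, up to sign, the coordinates of the unit vector `e 2` in the orthonormal frame formed
by the start, the direction and their cross product. -/
lemma coord_dir_sq_sum (s : GeodesicSegment) (e : OrthonormalBasis (Fin 3) ℝ E3) :
    ⟪e 2, (s.start : E3)⟫ ^ 2 + ⟪e 2, s.dir⟫ ^ 2 + s.axisHeight e ^ 2 = 1 := by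
  have h1 := coord_sq_sum e s.start
  have h2 : ⟪s.dir, s.dir⟫ = 1 := by rw [real_inner_self_eq_norm_sq, s.norm_dir]; norm_num
  have h3 := s.inner_start_dir
  rw [inner_eq_coord e] at h2 h3
  rw [axisHeight]
  generalize ⟪e 0, (s.start : E3)⟫ = a0 at *
  generalize ⟪e 1, (s.start : E3)⟫ = a1 at *
  generalize ⟪e 2, (s.start : E3)⟫ = a2 at *
  generalize ⟪e 0, s.dir⟫ = d0 at *
  generalize ⟪e 1, s.dir⟫ = d1 at *
  generalize ⟪e 2, s.dir⟫ = d2 at *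
  linear_combination (d0 ^ 2 + d1 ^ 2) * h1 + (1 - a2 ^ 2) * h2 -
    (a0 * d0 + a1 * d1 - a2 * d2) * h3

/-- The parallel transport of a spinor along a segment, up to a positive factor. -/
noncomputable def transport (s : GeodesicSegment) (e : OrthonormalBasis (Fin 3) ℝ E3) (t : ℝ) : ℂ :=
  (Real.cos (t / 2) * (1 + ⟪e 2, (s.start : E3)⟫) + Real.sin (t / 2) * ⟪e 2, s.dir⟫ : ℝ) +
    Complex.I * (Real.sin (t / 2) * s.axisHeight e : ℝ)

lemma hasDerivAt_transport (t : ℝ) : HasDerivAt (s.transport e)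
    (((-Real.sin (t / 2) * (1 + ⟪e 2, (s.start : E3)⟫) + Real.cos (t / 2) * ⟪e 2, s.dir⟫ : ℝ) +
      Complex.I * (Real.cos (t / 2) * s.axisHeight e : ℝ)) / 2) t := by
  have hc : HasDerivAt (fun t ↦ Real.cos (t / 2)) (-Real.sin (t / 2) * (1 / 2)) t :=
    ((hasDerivAt_id' t).div_const 2).cos
  have hs : HasDerivAt (fun t ↦ Real.sin (t / 2)) (Real.cos (t / 2) * (1 / 2)) t :=
    ((hasDerivAt_id' t).div_const 2).sin
  have h := ((hc.mul_const (1 + ⟪e 2, (s.start : E3)⟫)).add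
    (hs.mul_const ⟪e 2, s.dir⟫)).ofReal_comp.add
      ((hs.mul_const (s.axisHeight e)).ofReal_comp.const_mul Complex.I)
  refine h.congr_deriv ?_
  push_cast
  ring

/-- With n = `axisHeight` and h the height, this says that twice the logarithmic derivative of
`transport` is (h' + i n) / (1 + h): the real part is that of 1 + h, the imaginary part is the area
integrand. -/
lemma transport_ode (t : ℝ) : (1 + (⟪e 2, s.point t⟫ : ℂ)) *
    ((-Real.sin (t / 2) * (1 + ⟪e 2, (s.start : E3)⟫) + Real.cos (t / 2) * ⟪e 2, s.dir⟫ : ℝ) +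
      Complex.I * (Real.cos (t / 2) * s.axisHeight e : ℝ)) =
    (⟪e 2, s.velocity t⟫ + Complex.I * s.axisHeight e) * s.transport e t := by
  have h1 := s.coord_dir_sq_sum e
  have h2 := Real.sin_sq_add_cos_sq (t / 2)
  have hc : Real.cos t = 2 * Real.cos (t / 2) ^ 2 - 1 := by
    rw [← Real.cos_two_mul]; congr 1; ring
  have hs : Real.sin t = 2 * Real.sin (t / 2) * Real.cos (t / 2) := by
    rw [← Real.sin_two_mul]; congr 1; ring
  rw [inner_point, inner_velocity, transport, hc, hs]
  generalize ⟪e 2, (s.start : E3)⟫ = h at *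
  generalize ⟪e 2, s.dir⟫ = k at *
  generalize s.axisHeight e = n at *
  generalize Real.cos (t / 2) = c at *
  generalize Real.sin (t / 2) = d at *
  apply Complex.ext
  · simp only [Complex.add_re, Complex.mul_re, Complex.ofReal_re, Complex.ofReal_im,
      Complex.I_re, Complex.I_im, Complex.add_im, Complex.mul_im, Complex.one_re, Complex.one_im]
    simp
    linear_combination d * h1 - 2 * c * k * h2
  · simp only [Complex.add_re, Complex.mul_re, Complex.ofReal_re, Complex.ofReal_im,
      Complex.I_re, Complex.I_im, Complex.add_im, Complex.mul_im, Complex.one_re, Complex.one_im]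
    simp
    linear_combination 2 * c * h * n * h2

/-- By `transport_ode`, the quotient G of `transport` by √(1 + h) e^{iθ/2}, with θ the partial area
integral, has zero derivative; its value at the start is √(1 + h). -/
lemma exp_areaContribution (hs : -e 2 ∉ s.carrier) :
    Complex.exp (Complex.I * (s.areaContribution e / 2)) *
      (√(1 + ⟪e 2, (s.start : E3)⟫) * √(1 + ⟪e 2, s.finish⟫) : ℝ) = s.transport e s.len := by
  set θ : ℝ → ℝ := fun t ↦ ∫ r in (0 : ℝ)..t, s.axisHeight e / (1 + ⟪e 2, s.point r⟫) with hθ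
  set r : ℝ → ℝ := fun t ↦ √(1 + ⟪e 2, s.point t⟫) with hr
  have hpos : ∀ t ∈ Set.Icc 0 s.len, 0 < 1 + ⟪e 2, s.point t⟫ := fun t ht ↦
    one_add_height_point_pos hs ht
  have hcont : Continuous fun t ↦ 1 + ⟪e 2, s.point t⟫ := by fun_prop
  have hθd : ∀ t ∈ Set.Icc 0 s.len,
      HasDerivAt θ (s.axisHeight e / (1 + ⟪e 2, s.point t⟫)) t := fun t ht ↦ by
    refine intervalIntegral.integral_hasDerivAt_right ?_ ?_ ?_
    · refine ContinuousOn.intervalIntegrable ?_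
      rw [Set.uIcc_of_le ht.1]
      exact continuousOn_const.div hcont.continuousOn fun r hr ↦
        (hpos r ⟨hr.1, hr.2.trans ht.2⟩).ne'
    · exact (hcont.measurable.const_div _).stronglyMeasurable.stronglyMeasurableAtFilter
    · exact continuousAt_const.div hcont.continuousAt (hpos t ht).ne'
  set G : ℝ → ℂ := fun t ↦
    s.transport e t * Complex.exp (-(Complex.I * (θ t / 2))) / (r t : ℂ) with hG
  have hr0 : ∀ t ∈ Set.Icc 0 s.len, (r t : ℂ) ≠ 0 := fun t ht ↦ by
    exact_mod_cast (Real.sqrt_pos.2 (hpos t ht)).ne'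
  have hrsq : ∀ t ∈ Set.Icc 0 s.len, (1 + (⟪e 2, s.point t⟫ : ℂ)) = (r t : ℂ) ^ 2 := fun t ht ↦ by
    have := Real.sq_sqrt (hpos t ht).le
    exact_mod_cast this.symm
  have hGd : ∀ t ∈ Set.Icc 0 s.len, HasDerivAt G 0 t := fun t ht ↦ by
    have hrd : HasDerivAt r (⟪e 2, s.velocity t⟫ / (2 * r t)) t :=
      ((s.hasDerivAt_inner_point (e 2) t).const_add 1).sqrt (hpos t ht).ne'
    have hu := ((((hθd t ht).ofReal_comp.div_const 2).const_mul Complex.I).neg).cexp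
    have h := ((hasDerivAt_transport (s := s) (e := e) t).mul hu).div hrd.ofReal_comp (hr0 t ht)
    refine h.congr_deriv ?_
    have hode := transport_ode (s := s) (e := e) t
    rw [hrsq t ht] at hode
    have hr1 := hr0 t ht
    push_cast at hode ⊢
    rw [hrsq t ht]
    simp only [Pi.mul_apply]
    field_simp
    generalize Complex.exp _ = E
    linear_combination E * hode
  have hconst := constant_of_has_deriv_right_zero (f := G)
    (fun t ht ↦ (hGd t ht).continuousAt.continuousWithinAt)
    (fun t ht ↦ (hGd t (Set.Ico_subset_Icc_self ht)).hasDerivWithinAt) s.len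
    ⟨s.len_nonneg, le_rfl⟩
  have h0m : (0 : ℝ) ∈ Set.Icc 0 s.len := ⟨le_rfl, s.len_nonneg⟩
  have hlm : s.len ∈ Set.Icc 0 s.len := ⟨s.len_nonneg, le_rfl⟩
  have hp0 : s.point 0 = s.start := by simp [point]
  have hG0 : G 0 = r 0 := by
    have h1 : s.transport e 0 = (r 0 : ℂ) ^ 2 := by
      rw [← hrsq 0 h0m, hp0]; simp [transport]
    simp only [hG, h1]
    have := hr0 0 h0m
    simp only [hθ, intervalIntegral.integral_same]
    field_simp
    simp
  rw [hG0] at hconst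
  have h1 := hr0 s.len hlm
  have hr0' : √(1 + ⟪e 2, (s.start : E3)⟫) = r 0 := by rw [hr]; simp only [hp0]
  have hrl : √(1 + ⟪e 2, s.finish⟫) = r s.len := rfl
  have hA : s.areaContribution e = θ s.len := rfl
  rw [hr0', hrl, hA, Complex.ofReal_mul, ← hconst, hG]
  simp only
  rw [div_mul_cancel₀ _ h1, mul_comm, mul_assoc, ← Complex.exp_add]
  simp

/-- Eliminates direction and length in favour of the midpoint, the only datum of the side that the
theorem prescribes. -/
lemma transport_len (s : GeodesicSegment) (e : OrthonormalBasis (Fin 3) ℝ E3) :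
    s.transport e s.len = conj (⟪e 2, s.midpoint⟫ * (1 + ⟪e 2, (s.start : E3)⟫) +
      conj (planePart e s.midpoint) * planePart e s.start) := by
  have h := inner_start_point s (s.len / 2)
  have h1 := s.inner_point (e 0) (s.len / 2)
  have h2 := s.inner_point (e 1) (s.len / 2)
  have h3 := s.inner_point (e 2) (s.len / 2)
  have h4 := coord_sq_sum e s.start
  have h5 := s.inner_start_dir
  rw [inner_eq_coord e] at h5
  rw [transport, midpoint, axisHeight]
  simp only [planePart]
  rw [h1, h2, h3]
  generalize ⟪e 0, (s.start : E3)⟫ = a0 at *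
  generalize ⟪e 1, (s.start : E3)⟫ = a1 at *
  generalize ⟪e 2, (s.start : E3)⟫ = a2 at *
  generalize ⟪e 0, s.dir⟫ = d0 at *
  generalize ⟪e 1, s.dir⟫ = d1 at *
  generalize ⟪e 2, s.dir⟫ = d2 at *
  generalize Real.cos (s.len / 2) = c at *
  generalize Real.sin (s.len / 2) = d at *
  apply Complex.ext
  · simp
    linear_combination -c * h4 - d * h5
  · simp
    ring

end GeodesicSegment

/-! ### Determinants, the corner vector and majority signs. -/

lemma det3_eq (u v w : E3) : det3 u v w =
    u 0 * v 1 * w 2 - u 0 * v 2 * w 1 - u 1 * v 0 * w 2 + u 1 * v 2 * w 0 + u 2 * v 0 * w 1 -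
      u 2 * v 1 * w 0 := by
  rw [det3, Matrix.det_fin_three]
  simp

lemma inner_eq_sum_three (u v : E3) : ⟪u, v⟫ = u 0 * v 0 + u 1 * v 1 + u 2 * v 2 := by
  simp [PiLp.inner_apply, Fin.sum_univ_three, mul_comm]

/-- The square of the determinant is the Gram determinant. -/
lemma det3_sq (u v w : S2) : det3 u v w ^ 2 =
    1 + 2 * ⟪(u : E3), v⟫ * ⟪(v : E3), w⟫ * ⟪(w : E3), u⟫ - ⟪(u : E3), v⟫ ^ 2 -
      ⟪(v : E3), w⟫ ^ 2 - ⟪(w : E3), u⟫ ^ 2 := by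
  have hu := inner_self_sphere u
  have hv := inner_self_sphere v
  have hw := inner_self_sphere w
  have key : det3 u v w ^ 2 = ⟪(u : E3), u⟫ * ⟪(v : E3), v⟫ * ⟪(w : E3), w⟫ +
      2 * ⟪(u : E3), v⟫ * ⟪(v : E3), w⟫ * ⟪(w : E3), u⟫ - ⟪(u : E3), v⟫ ^ 2 * ⟪(w : E3), w⟫ -
      ⟪(v : E3), w⟫ ^ 2 * ⟪(u : E3), u⟫ - ⟪(w : E3), u⟫ ^ 2 * ⟪(v : E3), v⟫ := by
    simp only [det3_eq, inner_eq_sum_three]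
    ring
  rw [key, hu, hv, hw]
  ring

lemma det3_eq_coord (e : OrthonormalBasis (Fin 3) ℝ E3) (he : det3 (e 0) (e 1) (e 2) = 1)
    (u v w : E3) : det3 u v w =
      ⟪e 0, u⟫ * ⟪e 1, v⟫ * ⟪e 2, w⟫ - ⟪e 0, u⟫ * ⟪e 2, v⟫ * ⟪e 1, w⟫ -
      ⟪e 1, u⟫ * ⟪e 0, v⟫ * ⟪e 2, w⟫ + ⟪e 1, u⟫ * ⟪e 2, v⟫ * ⟪e 0, w⟫ +
      ⟪e 2, u⟫ * ⟪e 0, v⟫ * ⟪e 1, w⟫ - ⟪e 2, u⟫ * ⟪e 1, v⟫ * ⟪e 0, w⟫ := by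
  rw [← mul_one (det3 u v w), ← he]
  simp only [det3_eq, inner_eq_sum_three]
  ring

/-- The vector along which the starting corner of a triangle with given midpoints lies. -/
noncomputable def cornerVector (α β γ : E3) : E3 := ⟪γ, α⟫ • β - ⟪β, γ⟫ • α + ⟪α, β⟫ • γ

lemma norm_cornerVector_sq (α β γ : S2) :
    ⟪cornerVector α β γ, cornerVector α β γ⟫ = 1 - det3 α β γ ^ 2 := by
  rw [det3_sq, cornerVector]
  simp only [inner_add_left, inner_add_right, inner_sub_left, inner_sub_right, inner_smul_left,
    inner_smul_right, inner_self_sphere, real_inner_comm (α : E3) β, real_inner_comm (β : E3) γ,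
    real_inner_comm (γ : E3) α]
  simp
  ring

lemma inner_cornerVector (α β γ : S2) :
    ⟪cornerVector α β γ, (γ : E3)⟫ = ⟪(α : E3), β⟫ := by
  rw [cornerVector]
  simp only [inner_add_left, inner_sub_left, inner_smul_left, inner_self_sphere,
    real_inner_comm (γ : E3) α]
  simp
  ring

lemma one_sub_det3_sq_pos {α β γ : S2} (hαβ : ⟪(α : E3), (β : E3)⟫ ≠ 0) :
    0 < 1 - det3 α β γ ^ 2 := by
  rw [← norm_cornerVector_sq]
  refine real_inner_self_pos.2 fun h ↦ hαβ ?_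
  rw [← inner_cornerVector α β γ, h, inner_zero_left]

lemma majoritySign_eq_one {x y z : ℝ} (hx : x ≠ 0) (hy : y ≠ 0) (hz : z ≠ 0)
    (hxy : ¬(x < 0 ∧ y < 0)) (hyz : ¬(y < 0 ∧ z < 0)) (hzx : ¬(z < 0 ∧ x < 0)) :
    majoritySign x y z = 1 := by
  rw [majoritySign]
  apply Real.sign_of_pos
  rcases hx.lt_or_gt with hx | hx <;> rcases hy.lt_or_gt with hy | hy <;>
    rcases hz.lt_or_gt with hz | hz <;>
    simp_all [Real.sign_of_neg, Real.sign_of_pos]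
  norm_num

lemma majoritySign_neg (x y z : ℝ) : majoritySign (-x) (-y) (-z) = -majoritySign x y z := by
  simp only [majoritySign, Real.sign_neg]
  rw [← neg_add, ← neg_add, Real.sign_neg]

/-- Used with x, y, z the products of corners and midpoints: at most one is negative, so a common
factor k determines the majority alone. -/
lemma majoritySign_mul {k x y z : ℝ} (hk : k ≠ 0) (hx : x ≠ 0) (hy : y ≠ 0) (hz : z ≠ 0)
    (hxy : ¬(x < 0 ∧ y < 0)) (hyz : ¬(y < 0 ∧ z < 0)) (hzx : ¬(z < 0 ∧ x < 0)) :
    majoritySign (k * x) (k * y) (k * z) = Real.sign k := by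
  have h := majoritySign_eq_one hx hy hz hxy hyz hzx
  have hs : ∀ k x : ℝ, 0 < k → Real.sign (k * x) = Real.sign x := fun k x hk ↦ by
    rcases lt_trichotomy x 0 with hx | hx | hx
    · rw [Real.sign_of_neg hx, Real.sign_of_neg (mul_neg_of_pos_of_neg hk hx)]
    · simp [hx]
    · rw [Real.sign_of_pos hx, Real.sign_of_pos (mul_pos hk hx)]
  have hp : ∀ k : ℝ, 0 < k → majoritySign (k * x) (k * y) (k * z) = 1 := fun k hk ↦ by
    rw [← h]; simp only [majoritySign, hs k _ hk]
  rcases hk.lt_or_gt with hk | hk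
  · have := hp (-k) (by linarith)
    simp only [neg_mul, majoritySign_neg] at this
    rw [Real.sign_of_neg hk]; linarith
  · rw [hp k hk, Real.sign_of_pos hk]

lemma majoritySign_eq_or {x y z : ℝ} (hx : x ≠ 0) (hy : y ≠ 0) (hz : z ≠ 0) :
    (majoritySign x y z = 1 ∧ ¬(x < 0 ∧ y < 0) ∧ ¬(y < 0 ∧ z < 0) ∧ ¬(z < 0 ∧ x < 0)) ∨
    (majoritySign x y z = -1 ∧ ¬(0 < x ∧ 0 < y) ∧ ¬(0 < y ∧ 0 < z) ∧ ¬(0 < z ∧ 0 < x)) := by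
  by_cases h : ¬(x < 0 ∧ y < 0) ∧ ¬(y < 0 ∧ z < 0) ∧ ¬(z < 0 ∧ x < 0)
  · exact .inl ⟨majoritySign_eq_one hx hy hz h.1 h.2.1 h.2.2, h⟩
  · have h' : ¬(0 < x ∧ 0 < y) ∧ ¬(0 < y ∧ 0 < z) ∧ ¬(0 < z ∧ 0 < x) := by
      refine ⟨fun h1 ↦ h ?_, fun h1 ↦ h ?_, fun h1 ↦ h ?_⟩ <;>
      refine ⟨fun h2 ↦ ?_, fun h2 ↦ ?_, fun h2 ↦ ?_⟩ <;> linarith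
    refine .inr ⟨?_, h'⟩
    have := majoritySign_eq_one (neg_ne_zero.2 hx) (neg_ne_zero.2 hy) (neg_ne_zero.2 hz)
      (by simpa using h'.1) (by simpa using h'.2.1) (by simpa using h'.2.2)
    rw [majoritySign_neg] at this
    linarith

/-! ### Existence and uniqueness of the triangle. -/

namespace GeodesicSegment

lemma pi_lt_len_iff (s : GeodesicSegment) :
    Real.pi < s.len ↔ ⟪(s.start : E3), s.midpoint⟫ < 0 := by
  rw [midpoint, inner_start_point]
  have h1 := s.len_nonneg
  have h2 := s.len_le
  rw [← Real.cos_pi_div_two, Real.strictAntiOn_cos.lt_iff_gt ⟨by linarith, by linarith⟩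
    ⟨by linarith [Real.pi_pos], by linarith [Real.pi_pos]⟩]
  constructor <;> intro <;> linarith

/-- The cosine of half the length is ⟪start, midpoint⟫, which determines the length; if it lies
strictly between 0 and 2π, the sine of its half is nonzero and the direction can be read off the
midpoint. -/
lemma same_of_start_midpoint {s s' : GeodesicSegment} (hs : s.start = s'.start)
    (hm : s.midpoint = s'.midpoint) : s.Same s' := by
  have hlen : s.len = s'.len := by
    have h1 := inner_start_point s (s.len / 2)
    have h2 := inner_start_point s' (s'.len / 2)
    change ⟪_, s.midpoint⟫ = _ at h1
    change ⟪_, s'.midpoint⟫ = _ at h2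
    rw [hs, hm, h2] at h1
    have := Real.injOn_cos ⟨by linarith [s'.len_nonneg], by linarith [s'.len_le]⟩
      ⟨by linarith [s.len_nonneg], by linarith [s.len_le]⟩ h1
    linarith
  refine ⟨hs, by rw [finish_eq, finish_eq, hs, hm], hlen, fun hlt t ht ↦ ?_⟩
  rcases s.len_nonneg.eq_or_lt with h0 | h0
  · rw [← h0] at ht
    obtain rfl : t = 0 := le_antisymm ht.2 ht.1
    simp [point, hs]
  · have hsin := Real.sin_pos_of_pos_of_lt_pi (x := s.len / 2) (by linarith) (by linarith)
    have hd : s.dir = s'.dir := by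
      rw [midpoint, midpoint, ← hlen, point, point, hs, add_right_inj] at hm
      exact smul_right_injective _ hsin.ne' hm
    rw [point, point, hs, hd]

lemma exists_start_midpoint (a m : S2) :
    ∃ s : GeodesicSegment, s.start = a ∧ s.midpoint = m := by
  set c := ⟪(a : E3), (m : E3)⟫ with hc
  obtain ⟨h1, h2⟩ := abs_le.1 (abs_inner_le_one a m)
  have hw : ⟪(a : E3), (m : E3) - c • (a : E3)⟫ = 0 := by
    rw [inner_sub_right, inner_smul_right, inner_self_sphere]; simp [hc]
  have hn : ‖(m : E3) - c • (a : E3)‖ = √(1 - c ^ 2) := by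
    rw [norm_eq_sqrt_real_inner]
    congr 1
    simp only [inner_sub_left, inner_sub_right, inner_smul_left, inner_smul_right,
      inner_self_sphere, real_inner_comm (a : E3) m, ← hc]
    simp
    ring
  have hdir : ∃ d : E3, ‖d‖ = 1 ∧ ⟪(a : E3), d⟫ = 0 ∧
      (m : E3) = c • (a : E3) + √(1 - c ^ 2) • d := by
    -- Here m = ±a, the segment has length 0 or 2π, and any tangent direction serves.
    by_cases h0 : (m : E3) - c • (a : E3) = 0
    · obtain ⟨b, hb⟩ := exists_orthonormalBasis_apply_two a
      refine ⟨b 0, b.norm_eq_one 0, ?_, ?_⟩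
      · rw [← hb]; exact b.inner_eq_zero (by decide)
      · rw [← hn, h0, norm_zero, zero_smul, add_zero]
        exact sub_eq_zero.1 h0
    · refine ⟨‖(m : E3) - c • (a : E3)‖⁻¹ • ((m : E3) - c • (a : E3)), norm_smul_inv_norm h0,
        ?_, ?_⟩
      · rw [inner_smul_right, hw, mul_zero]
      · rw [← hn, smul_inv_smul₀ (norm_ne_zero_iff.2 h0)]
        abel
  obtain ⟨d, hd1, hd2, hd3⟩ := hdir
  refine ⟨⟨a, d, hd1, hd2, 2 * Real.arccos c, by linarith [Real.arccos_nonneg c],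
    by linarith [Real.arccos_le_pi c]⟩, rfl, ?_⟩
  rw [midpoint, point]
  simp only [mul_div_cancel_left₀ _ (two_ne_zero (α := ℝ))]
  rw [Real.cos_arccos h1 h2, Real.sin_arccos]
  exact hd3.symm

end GeodesicSegment

namespace GeodesicTriangle

variable {α β γ : S2} {T : GeodesicTriangle}

lemma corners_of_hasMidpoints (h : T.HasMidpoints α β γ) (hαβ : ⟪(α : E3), (β : E3)⟫ ≠ 0)
    (hβγ : ⟪(β : E3), (γ : E3)⟫ ≠ 0) (hγα : ⟪(γ : E3), (α : E3)⟫ ≠ 0) :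
    (majoritySign ⟪(α : E3), (β : E3)⟫ ⟪(β : E3), (γ : E3)⟫ ⟪(γ : E3), (α : E3)⟫ *
      √(1 - det3 α β γ ^ 2)) • (T.ab.start : E3) = cornerVector α β γ := by
  obtain ⟨h1, h2, h3⟩ := h
  have hab := T.ab.finish_eq
  have hbc := T.bc.finish_eq
  have hca := T.ca.finish_eq
  have l1 := T.not_long_ab_bc
  have l2 := T.not_long_bc_ca
  have l3 := T.not_long_ca_ab
  simp only [GeodesicSegment.pi_lt_len_iff] at l1 l2 l3
  rw [T.ab_finish, h3] at hab
  rw [T.bc_finish, h1] at hbc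
  rw [T.ca_finish, h2] at hca
  rw [h3, h1] at l1
  rw [h1, h2] at l2
  rw [h2, h3] at l3
  set a := T.ab.start
  set b := T.bc.start
  set c := T.ca.start
  set x := ⟪(a : E3), (γ : E3)⟫ with hx
  set y := ⟪(b : E3), (α : E3)⟫ with hy
  set w := ⟪(c : E3), (β : E3)⟫ with hw
  -- The composite of the three half-turns fixes a; substituting them into one another gives 2a.
  have hsum : (a : E3) = w • (β : E3) - y • (α : E3) + x • (γ : E3) := by
    have : (2 : ℝ) • (a : E3) = (2 : ℝ) • (w • (β : E3) - y • (α : E3) + x • (γ : E3)) := by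
      rw [two_smul]
      nth_rewrite 1 [hca]
      rw [hbc, hab]
      module
    exact smul_right_injective _ two_ne_zero this
  have ewa : ⟪(a : E3), (β : E3)⟫ = w := by
    rw [hca, inner_sub_left, inner_smul_left, inner_self_sphere, ← hw]; simp; ring
  have e1 : w * ⟪(β : E3), (γ : E3)⟫ = y * ⟪(γ : E3), (α : E3)⟫ := by
    have := congrArg (fun v ↦ ⟪v, (γ : E3)⟫) hsum
    simp only [inner_add_left, inner_sub_left, inner_smul_left, inner_self_sphere,
      real_inner_comm (γ : E3) α, ← hx] at this
    simp at this
    linarith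
  have e2 : y * ⟪(α : E3), (β : E3)⟫ = x * ⟪(β : E3), (γ : E3)⟫ := by
    have := ewa
    rw [hsum] at this
    simp only [inner_add_left, inner_sub_left, inner_smul_left, inner_self_sphere,
      real_inner_comm (β : E3) γ] at this
    simp at this
    linarith
  set p := ⟪(α : E3), (β : E3)⟫ with hp
  set q := ⟪(β : E3), (γ : E3)⟫ with hq
  set r := ⟪(γ : E3), (α : E3)⟫ with hr
  -- Otherwise y and w vanish as well, and `hsum` gives a = 0.
  have hx0 : x ≠ 0 := by
    intro h0
    have hy0 : y = 0 := by
      rw [h0, zero_mul] at e2; exact (mul_eq_zero.1 e2).resolve_right hαβ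
    have hw0 : w = 0 := by
      rw [hy0, zero_mul] at e1; exact (mul_eq_zero.1 e1).resolve_right hβγ
    have := inner_self_sphere a
    rw [hsum, h0, hy0, hw0] at this
    simp at this
  set k := p / x with hk
  have hk0 : k ≠ 0 := div_ne_zero hαβ hx0
  have k1 : p = k * x := by rw [hk]; field_simp
  have k2 : q = k * y := by rw [hk]; field_simp; linarith
  have k3 : r = k * w := by
    have : y * r = y * (k * w) := by rw [← e1, k2]; ring
    refine mul_left_cancel₀ ?_ this
    rintro h0
    rw [h0, mul_zero] at k2
    exact hβγ k2
  have hka : k • (a : E3) = cornerVector α β γ := by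
    rw [cornerVector, ← hp, ← hq, ← hr, k1, k2, k3, hsum]
    module
  have hk2 : k ^ 2 = 1 - det3 α β γ ^ 2 := by
    rw [← norm_cornerVector_sq, ← hka, inner_smul_left, inner_smul_right, inner_self_sphere]
    simp; ring
  have hy0 : y ≠ 0 := by rintro h0; rw [h0, mul_zero] at k2; exact hβγ k2
  have hw0 : w ≠ 0 := by rintro h0; rw [h0, mul_zero] at k3; exact hγα k3
  rw [← hk2, Real.sqrt_sq_eq_abs, k1, k2, k3, majoritySign_mul hk0 hx0 hy0 hw0 l1 l2 l3,
    ← hka]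
  congr 1
  rcases hk0.lt_or_gt with h0 | h0
  · rw [Real.sign_of_neg h0, abs_of_neg h0]; ring
  · rw [Real.sign_of_pos h0, abs_of_pos h0]; ring

lemma exists_hasMidpoints (hαβ : ⟪(α : E3), (β : E3)⟫ ≠ 0)
    (hβγ : ⟪(β : E3), (γ : E3)⟫ ≠ 0) (hγα : ⟪(γ : E3), (α : E3)⟫ ≠ 0) :
    ∃ T : GeodesicTriangle, T.HasMidpoints α β γ := by
  have hpos := one_sub_det3_sq_pos (γ := γ) hαβ
  -- The square root with the majority sign: dividing by it leaves at most one negative product, so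
  -- at most one long side.
  obtain ⟨k, hk2, hsign⟩ : ∃ k : ℝ, k ^ 2 = 1 - det3 α β γ ^ 2 ∧
      ¬(⟪(α : E3), (β : E3)⟫ / k < 0 ∧ ⟪(β : E3), (γ : E3)⟫ / k < 0) ∧
      ¬(⟪(β : E3), (γ : E3)⟫ / k < 0 ∧ ⟪(γ : E3), (α : E3)⟫ / k < 0) ∧
      ¬(⟪(γ : E3), (α : E3)⟫ / k < 0 ∧ ⟪(α : E3), (β : E3)⟫ / k < 0) := by
    have hs := Real.sqrt_pos.2 hpos
    rcases majoritySign_eq_or hαβ hβγ hγα with ⟨-, h⟩ | ⟨-, h⟩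
    · refine ⟨√(1 - det3 α β γ ^ 2), Real.sq_sqrt hpos.le, ?_⟩
      simpa only [div_lt_iff₀ hs, zero_mul] using h
    · refine ⟨-√(1 - det3 α β γ ^ 2), by rw [neg_sq, Real.sq_sqrt hpos.le], ?_⟩
      simpa only [div_neg, neg_lt_zero, lt_div_iff₀ hs, zero_mul] using h
  have hk0 : k ≠ 0 := by rintro rfl; simp at hk2; linarith
  have corner : ∀ α β γ : S2, k ^ 2 = 1 - det3 α β γ ^ 2 →
      k⁻¹ • cornerVector α β γ ∈ Metric.sphere (0 : E3) 1 ∧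
      ⟪k⁻¹ • cornerVector α β γ, (γ : E3)⟫ = ⟪(α : E3), β⟫ / k := fun α β γ hk ↦ by
    constructor
    · rw [mem_sphere_zero_iff_norm, ← pow_eq_one_iff_of_nonneg (norm_nonneg _) two_ne_zero,
        ← real_inner_self_eq_norm_sq, inner_smul_left, inner_smul_right, norm_cornerVector_sq, ← hk]
      simp
      field_simp
    · rw [inner_smul_left, inner_cornerVector]
      simp
      field_simp
  have d1 : det3 β γ α = det3 α β γ := by simp only [det3_eq]; ring
  have d2 : det3 γ α β = det3 α β γ := by simp only [det3_eq]; ring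
  obtain ⟨a1, a2⟩ := corner α β γ hk2
  obtain ⟨b1, b2⟩ := corner β γ α (by rw [d1, hk2])
  obtain ⟨c1, c2⟩ := corner γ α β (by rw [d2, hk2])
  obtain ⟨ab, hab, mab⟩ := GeodesicSegment.exists_start_midpoint ⟨_, a1⟩ γ
  obtain ⟨bc, hbc, mbc⟩ := GeodesicSegment.exists_start_midpoint ⟨_, b1⟩ α
  obtain ⟨ca, hca, mca⟩ := GeodesicSegment.exists_start_midpoint ⟨_, c1⟩ β
  have iab : ⟪(ab.start : E3), ab.midpoint⟫ = ⟪(α : E3), β⟫ / k := by rw [hab, mab]; exact a2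
  have ibc : ⟪(bc.start : E3), bc.midpoint⟫ = ⟪(β : E3), γ⟫ / k := by rw [hbc, mbc]; exact b2
  have ica : ⟪(ca.start : E3), ca.midpoint⟫ = ⟪(γ : E3), α⟫ / k := by rw [hca, mca]; exact c2
  refine ⟨⟨ab, bc, ca, ?_, ?_, ?_, ?_, ?_, ?_⟩, mbc, mca, mab⟩
  · rw [ab.finish_eq, iab, mab, hab, hbc]
    simp only [cornerVector, div_eq_mul_inv]
    module
  · rw [bc.finish_eq, ibc, mbc, hbc, hca]
    simp only [cornerVector, div_eq_mul_inv]
    module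
  · rw [ca.finish_eq, ica, mca, hca, hab]
    simp only [cornerVector, div_eq_mul_inv]
    module
  · rw [ab.pi_lt_len_iff, bc.pi_lt_len_iff, iab, ibc]; exact hsign.1
  · rw [bc.pi_lt_len_iff, ca.pi_lt_len_iff, ibc, ica]; exact hsign.2.1
  · rw [ca.pi_lt_len_iff, ab.pi_lt_len_iff, ica, iab]; exact hsign.2.2

lemma same_of_hasMidpoints {T' : GeodesicTriangle} (h : T.HasMidpoints α β γ)
    (h' : T'.HasMidpoints α β γ) (hαβ : ⟪(α : E3), (β : E3)⟫ ≠ 0)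
    (hβγ : ⟪(β : E3), (γ : E3)⟫ ≠ 0) (hγα : ⟪(γ : E3), (α : E3)⟫ ≠ 0) : T.Same T' := by
  have c := corners_of_hasMidpoints h hαβ hβγ hγα
  have c' := corners_of_hasMidpoints h' hαβ hβγ hγα
  have hpos := one_sub_det3_sq_pos (γ := γ) hαβ
  have hk : majoritySign ⟪(α : E3), (β : E3)⟫ ⟪(β : E3), (γ : E3)⟫ ⟪(γ : E3), (α : E3)⟫ *
      √(1 - det3 α β γ ^ 2) ≠ 0 := by
    refine mul_ne_zero ?_ (Real.sqrt_pos.2 hpos).ne'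
    rcases majoritySign_eq_or hαβ hβγ hγα with ⟨h, -⟩ | ⟨h, -⟩ <;> rw [h] <;> norm_num
  have ha : T.ab.start = T'.ab.start :=
    Subtype.ext (smul_right_injective _ hk (c.trans c'.symm))
  have sab := GeodesicSegment.same_of_start_midpoint ha (h.2.2.trans h'.2.2.symm)
  have hb : T.bc.start = T'.bc.start :=
    Subtype.ext (by rw [← T.ab_finish, ← T'.ab_finish, sab.2.1])
  have sbc := GeodesicSegment.same_of_start_midpoint hb (h.1.trans h'.1.symm)
  have hc : T.ca.start = T'.ca.start :=
    Subtype.ext (by rw [← T.bc_finish, ← T'.bc_finish, sbc.2.1])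
  exact ⟨ha, hb, hc, sab, sbc, GeodesicSegment.same_of_start_midpoint hc (h.2.1.trans h'.2.1.symm)⟩

end GeodesicTriangle

/-! ### Spinors and Pauli matrices. -/

/-- The pairing of the spinors of the starting point and of the midpoint of a segment. -/
noncomputable def spinorPairing (e : OrthonormalBasis (Fin 3) ℝ E3) (a m : E3) : ℂ :=
  ⟪e 2, m⟫ * (1 + ⟪e 2, a⟫) + conj (planePart e m) * planePart e a

lemma planePart_sub (e : OrthonormalBasis (Fin 3) ℝ E3) (u v : E3) :
    planePart e (u - v) = planePart e u - planePart e v := by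
  simp only [planePart, inner_sub_right]; push_cast; ring

lemma planePart_add (e : OrthonormalBasis (Fin 3) ℝ E3) (u v : E3) :
    planePart e (u + v) = planePart e u + planePart e v := by
  simp only [planePart, inner_add_right]; push_cast; ring

lemma planePart_smul (e : OrthonormalBasis (Fin 3) ℝ E3) (r : ℝ) (v : E3) :
    planePart e (r • v) = r * planePart e v := by
  simp only [planePart, inner_smul_right]; push_cast; ring

/-- Since σ_m σ_a σ_m = σ_b for the half-turn b of a about m, σ_m ψ_a is a +1 eigenvector of σ_b,
hence proportional to ψ_b; `spinorPairing` is its first component. -/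
lemma spinor_reflection (e : OrthonormalBasis (Fin 3) ℝ E3) {a m b : S2}
    (h : (b : E3) = (2 * ⟪(a : E3), m⟫) • (m : E3) - a) :
    (1 + (⟪e 2, (b : E3)⟫ : ℂ)) *
      (planePart e m * (1 + ⟪e 2, (a : E3)⟫) - ⟪e 2, (m : E3)⟫ * planePart e a) =
      spinorPairing e a m * planePart e b := by
  have ha := planePart_mul_conj e a
  have hm := planePart_mul_conj e m
  have hc := inner_eq_planePart e a m
  rw [h, planePart_sub, planePart_smul, inner_sub_right, inner_smul_right, spinorPairing]
  push_cast
  linear_combination -planePart e m * ha - 2 * (⟪(a : E3), (m : E3)⟫ : ℂ) * planePart e a * hm -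
    2 * planePart e a * hc

/-- The upper left entry of σ_β σ_α σ_γ = σ_v - i det(αβγ), where v is the corner vector. -/
lemma pauli_product_diag (e : OrthonormalBasis (Fin 3) ℝ E3) (he : det3 (e 0) (e 1) (e 2) = 1)
    (α β γ : E3) :
    (⟪e 2, β⟫ : ℂ) * (⟪e 2, α⟫ * ⟪e 2, γ⟫ + conj (planePart e α) * planePart e γ) +
      conj (planePart e β) * (planePart e α * ⟪e 2, γ⟫ - ⟪e 2, α⟫ * planePart e γ) =
    ⟪e 2, cornerVector α β γ⟫ - Complex.I * det3 α β γ := by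
  rw [det3_eq_coord e he, cornerVector]
  simp only [inner_add_right, inner_sub_right, inner_smul_right, inner_eq_coord e α β,
    inner_eq_coord e β γ, inner_eq_coord e γ α, planePart, map_add, map_mul, Complex.conj_ofReal,
    Complex.conj_I]
  push_cast
  ring_nf
  simp only [Complex.I_sq]
  ring

/-- The upper right entry of the same identity; the scalar part does not contribute, so no
orientation is needed. -/
lemma pauli_product_offDiag (e : OrthonormalBasis (Fin 3) ℝ E3) (α β γ : E3) :
    (⟪e 2, β⟫ : ℂ) * (⟪e 2, α⟫ * conj (planePart e γ) - conj (planePart e α) * ⟪e 2, γ⟫) +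
      conj (planePart e β) * (planePart e α * conj (planePart e γ) + ⟪e 2, α⟫ * ⟪e 2, γ⟫) =
    conj (planePart e (cornerVector α β γ)) := by
  rw [cornerVector, planePart_add, planePart_sub, planePart_smul, planePart_smul, planePart_smul]
  simp only [inner_eq_coord e α β, inner_eq_coord e β γ, inner_eq_coord e γ α, planePart, map_add,
    map_sub, map_mul, Complex.conj_ofReal, Complex.conj_I]
  push_cast
  ring_nf
  simp only [Complex.I_sq, Complex.I_pow_three]
  ring

lemma spinor_product (e : OrthonormalBasis (Fin 3) ℝ E3) (he : det3 (e 0) (e 1) (e 2) = 1)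
    {α β γ a b c : S2} {k : ℝ} (hk : k • (a : E3) = cornerVector α β γ)
    (hab : (b : E3) = (2 * ⟪(a : E3), γ⟫) • (γ : E3) - a)
    (hbc : (c : E3) = (2 * ⟪(b : E3), α⟫) • (α : E3) - b) :
    spinorPairing e a γ * spinorPairing e b α * spinorPairing e c β =
      (1 + ⟪e 2, (a : E3)⟫) * (1 + ⟪e 2, (b : E3)⟫) * (1 + ⟪e 2, (c : E3)⟫) *
        (k - Complex.I * det3 α β γ) := by
  have h1 := spinor_reflection e hab
  have h2 := spinor_reflection e hbc
  have h3 := pauli_product_diag e he α β γ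
  have h4 := pauli_product_offDiag e (α : E3) β γ
  have h5 := planePart_mul_conj e a
  rw [← hk, inner_smul_right] at h3
  rw [← hk, planePart_smul, map_mul, Complex.conj_ofReal] at h4
  push_cast at h3
  unfold spinorPairing at *
  generalize planePart e a = A at *
  generalize planePart e b = B at *
  generalize planePart e c = C at *
  generalize planePart e α = P at *
  generalize planePart e β = Q at *
  generalize planePart e γ = R at *
  generalize (⟪e 2, (a : E3)⟫ : ℂ) = a2 at *
  generalize (⟪e 2, (b : E3)⟫ : ℂ) = b2 at *
  generalize (⟪e 2, (c : E3)⟫ : ℂ) = c2 at *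
  generalize (⟪e 2, (α : E3)⟫ : ℂ) = p2 at *
  generalize (⟪e 2, (β : E3)⟫ : ℂ) = q2 at *
  generalize (⟪e 2, (γ : E3)⟫ : ℂ) = r2 at *
  -- The first component of σ_β σ_α σ_γ ψ_a; `h5` expresses σ_a ψ_a = ψ_a.
  have hu : q2 * (p2 * (r2 * (1 + a2) + conj R * A) + conj P * (R * (1 + a2) - r2 * A)) +
      conj Q * (P * (r2 * (1 + a2) + conj R * A) - p2 * (R * (1 + a2) - r2 * A)) =
      (k - Complex.I * det3 α β γ) * (1 + a2) := by
    linear_combination (1 + a2) * h3 + A * h4 + k * h5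
  set F := r2 * (1 + a2) + conj R * A
  set w := R * (1 + a2) - r2 * A
  linear_combination (1 + b2) * (1 + c2) * hu - (1 + c2) * (q2 * conj P - conj Q * p2) * h1 -
    conj Q * F * h2

lemma GeodesicSegment.carrier_subset_span (s : GeodesicSegment) :
    s.carrier ⊆ (Submodule.span ℝ {(s.start : E3), s.dir} : Set E3) := by
  rintro _ ⟨t, -, rfl⟩
  exact Submodule.add_mem _
    (Submodule.smul_mem _ _ (Submodule.subset_span (by simp)))
    (Submodule.smul_mem _ _ (Submodule.subset_span (by simp)))

/-! ### The exponential of half the area, and exterior points. -/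

namespace GeodesicTriangle

variable {α β γ : S2} {T : GeodesicTriangle}

/-- When the three sides are multiplied, each corner's square root occurs twice, which cancels the
factors 1 + h in `spinor_product`. -/
lemma exp_areaAvoiding (h : T.HasMidpoints α β γ) (hαβ : ⟪(α : E3), (β : E3)⟫ ≠ 0)
    (hβγ : ⟪(β : E3), (γ : E3)⟫ ≠ 0) (hγα : ⟪(γ : E3), (α : E3)⟫ ≠ 0)
    {e : OrthonormalBasis (Fin 3) ℝ E3} (he : det3 (e 0) (e 1) (e 2) = 1)
    (hT : -e 2 ∉ T.boundary) :
    Complex.exp (Complex.I * (T.areaAvoiding e / 2)) =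
      (majoritySign ⟪(α : E3), (β : E3)⟫ ⟪(β : E3), (γ : E3)⟫ ⟪(γ : E3), (α : E3)⟫ : ℂ) *
          (√(1 - det3 α β γ ^ 2) : ℝ) + Complex.I * (det3 α β γ : ℝ) := by
  have hk := corners_of_hasMidpoints h hαβ hβγ hγα
  rw [areaAvoiding_eq_sum hT]
  simp only [boundary, Set.mem_union, not_or] at hT
  obtain ⟨⟨n1, n2⟩, n3⟩ := hT
  obtain ⟨m1, m2, m3⟩ := h
  have hab := T.ab.finish_eq
  have hbc := T.bc.finish_eq
  rw [T.ab_finish, m3] at hab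
  rw [T.bc_finish, m1] at hbc
  have hp := spinor_product e he hk hab hbc
  have e1 := GeodesicSegment.exp_areaContribution n1
  have e2 := GeodesicSegment.exp_areaContribution n2
  have e3 := GeodesicSegment.exp_areaContribution n3
  rw [GeodesicSegment.transport_len, T.ab_finish, m3] at e1
  rw [GeodesicSegment.transport_len, T.bc_finish, m1] at e2
  rw [GeodesicSegment.transport_len, T.ca_finish, m2] at e3
  have pos : ∀ s : GeodesicSegment, -e 2 ∉ s.carrier → 0 < 1 + ⟪e 2, (s.start : E3)⟫ :=
    fun s hs ↦ one_add_height_pos e fun h ↦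
      hs ⟨0, ⟨le_rfl, s.len_nonneg⟩, by simpa [GeodesicSegment.point] using h⟩
  have sq : ∀ s : GeodesicSegment, -e 2 ∉ s.carrier →
      (√(1 + ⟪e 2, (s.start : E3)⟫) : ℂ) ^ 2 = 1 + (⟪e 2, (s.start : E3)⟫ : ℂ) ∧
      (√(1 + ⟪e 2, (s.start : E3)⟫) : ℂ) ≠ 0 := fun s hs ↦ by
    have h1 := Real.sq_sqrt (pos s hs).le
    have h2 := (Real.sqrt_pos.2 (pos s hs)).ne'
    exact ⟨by exact_mod_cast h1, by exact_mod_cast h2⟩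
  obtain ⟨s1, z1⟩ := sq T.ab n1
  obtain ⟨s2, z2⟩ := sq T.bc n2
  obtain ⟨s3, z3⟩ := sq T.ca n3
  have hp' := congrArg conj hp
  unfold spinorPairing at hp'
  rw [map_mul, map_mul, ← e1, ← e2, ← e3] at hp'
  simp only [map_mul, map_sub, map_add, map_one, Complex.conj_ofReal, Complex.conj_I] at hp'
  rw [← s1, ← s2, ← s3] at hp'
  push_cast at hp' ⊢
  rw [add_div, add_div, mul_add, mul_add, Complex.exp_add, Complex.exp_add]
  have hne := mul_ne_zero (pow_ne_zero 2 z1) (mul_ne_zero (pow_ne_zero 2 z2) (pow_ne_zero 2 z3))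
  refine mul_left_cancel₀ hne ?_
  linear_combination hp'

/-- Three planes through the origin do not cover space; a vector outside them is normalised. -/
lemma exists_exterior_point (T : GeodesicTriangle) : ∃ n : S2, (n : E3) ∉ T.boundary := by
  set s : Fin 3 → GeodesicSegment := ![T.ab, T.bc, T.ca]
  have hne : ∀ i, Submodule.span ℝ {((s i).start : E3), (s i).dir} ≠ ⊤ := fun i h ↦ by
    have h1 := finrank_span_finset_le_card (R := ℝ) ({((s i).start : E3), (s i).dir} : Finset E3)
    have h2 : ({((s i).start : E3), (s i).dir} : Finset E3).card ≤ 2 := Finset.card_le_two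
    rw [Set.finrank, Finset.coe_pair, h, finrank_top] at h1
    simp at h1
    omega
  have hcov : ⋃ i, (Submodule.span ℝ {((s i).start : E3), (s i).dir} : Set E3) ≠ Set.univ := by
    intro h
    obtain ⟨i, hi⟩ := Subspace.exists_eq_top_of_iUnion_eq_univ h
    exact hne i hi
  obtain ⟨v, hv⟩ := (Set.ne_univ_iff_exists_notMem _).1 hcov
  rw [Set.mem_iUnion, not_exists] at hv
  have hv0 : v ≠ 0 := by
    rintro rfl
    exact hv 0 (Submodule.zero_mem _)
  have hn : ∀ i, ‖v‖⁻¹ • v ∉ (s i).carrier := fun i hi ↦ by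
    refine hv i ?_
    have h := Submodule.smul_mem _ ‖v‖ (GeodesicSegment.carrier_subset_span _ hi)
    rwa [smul_inv_smul₀ (norm_ne_zero_iff.2 hv0)] at h
  refine ⟨⟨‖v‖⁻¹ • v, by simpa using norm_smul_inv_norm (𝕜 := ℝ) hv0⟩, ?_⟩
  simp only [boundary, Set.mem_union, not_or]
  exact ⟨⟨hn 0, hn 1⟩, hn 2⟩

lemma exists_positive_basis (n : S2) :
    ∃ e : OrthonormalBasis (Fin 3) ℝ E3, det3 (e 0) (e 1) (e 2) = 1 ∧ e 2 = n := by
  obtain ⟨b, hb⟩ := exists_orthonormalBasis_apply_two n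
  have hn : ∀ i j, ⟪b i, b j⟫ = if i = j then (1 : ℝ) else 0 := fun i j ↦ by
    rw [orthonormal_iff_ite.1 b.orthonormal]
  have hsq : det3 (b 0) (b 1) (b 2) ^ 2 = 1 := by
    have h := det3_sq ⟨b 0, by simp⟩ ⟨b 1, by simp⟩ ⟨b 2, by simp⟩
    simpa [hn] using h
  rw [sq, mul_self_eq_one_iff] at hsq
  rcases hsq with h | h
  · exact ⟨b, h, hb⟩
  -- Reversing the first vector corrects the orientation and keeps `b 2`.
  · have ho : Orthonormal ℝ ![-b 0, b 1, b 2] := by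
      rw [orthonormal_iff_ite]
      intro i j
      fin_cases i <;> fin_cases j <;> simp [hn]
    have hspan : ⊤ ≤ Submodule.span ℝ (Set.range ![-b 0, b 1, b 2]) := by
      rw [top_le_iff]
      exact ho.linearIndependent.span_eq_top_of_card_eq_finrank (by simp)
    refine ⟨OrthonormalBasis.mk ho hspan, ?_, ?_⟩
    · simp only [OrthonormalBasis.coe_mk]
      simp only [det3_eq] at h ⊢
      simp
      linarith
    · simp [hb]

lemma exists_basis_avoiding (T : GeodesicTriangle) :
    ∃ e : OrthonormalBasis (Fin 3) ℝ E3, det3 (e 0) (e 1) (e 2) = 1 ∧ -e 2 ∉ T.boundary := by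
  obtain ⟨n, hn⟩ := T.exists_exterior_point
  obtain ⟨e, he, h2⟩ := exists_positive_basis ⟨-(n : E3), by simp⟩
  exact ⟨e, he, by rw [h2]; simpa using hn⟩

end GeodesicTriangle

theorem mainTheorem1 (α β γ : S2)
    (hαβ : ⟪(α : E3), (β : E3)⟫ ≠ 0)
    (hβγ : ⟪(β : E3), (γ : E3)⟫ ≠ 0)
    (hγα : ⟪(γ : E3), (α : E3)⟫ ≠ 0) :
    (∃ T : GeodesicTriangle, T.HasMidpoints α β γ) ∧
    (∀ T T' : GeodesicTriangle, T.HasMidpoints α β γ → T'.HasMidpoints α β γ → T.Same T') ∧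
    (∀ T : GeodesicTriangle, T.HasMidpoints α β γ → ∀ Ω : ℝ,
      T.IsOrientedArea Ω ↔
        Complex.exp (Complex.I * (Ω / 2)) =
          (majoritySign ⟪(α : E3), (β : E3)⟫ ⟪(β : E3), (γ : E3)⟫ ⟪(γ : E3), (α : E3)⟫ : ℂ) *
              (√(1 - det3 α β γ ^ 2) : ℝ) +
            Complex.I * (det3 α β γ : ℝ)) := by
  refine ⟨GeodesicTriangle.exists_hasMidpoints hαβ hβγ hγα,
    fun T T' h h' ↦ GeodesicTriangle.same_of_hasMidpoints h h' hαβ hβγ hγα,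
    fun T h Ω ↦ ⟨?_, fun hΩ ↦ ?_⟩⟩
  · rintro ⟨e, he, hT, k, rfl⟩
    rw [← GeodesicTriangle.exp_areaAvoiding h hαβ hβγ hγα he hT,
      Complex.exp_eq_exp_iff_exists_int]
    exact ⟨k, by push_cast; ring⟩
  -- Any admissible exterior point will do, since e^{iΩ/2} determines Ω modulo 4π.
  · obtain ⟨e, he, hT⟩ := T.exists_basis_avoiding
    rw [← GeodesicTriangle.exp_areaAvoiding h hαβ hβγ hγα he hT,
      Complex.exp_eq_exp_iff_exists_int] at hΩ
    obtain ⟨k, hk⟩ := hΩ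
    refine ⟨e, he, hT, k, ?_⟩
    have : Complex.I * (Ω : ℂ) = Complex.I * (T.areaAvoiding e + 4 * Real.pi * k) := by
      linear_combination 2 * hk
    exact_mod_cast mul_left_cancel₀ Complex.I_ne_zero this
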